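/- Let $q$ be a prime power. A linear $[n,k,d]_q$ code is a $k$-dimensional subspace $C\subseteq\mathbb F_q^n$ whose minimum Hamming distance between distinct codewords is $d$; it is non-degenerate if no coordinate vanishes on all of $C$; its Singleton defect is $n-k+1-d$, and $C$ is called A$^s$MDS if this defect is $s$ (MDS if $s=0$). The dual code is $C^\perp=\{y\in\mathbb F_q^n : y\cdot x=0 \text{ for all } x\in C\}$. Let $m(k,q)\in\mathbb N\cup\{\infty\}$ be the maximum (supremum) of the lengths of non-degenerate $k$-dimensional MDS codes over $\mathbb F_q$ (so $m(1,q)=\infty$). **Theorem.** Let $C$ be a non-degenerate $[n,k,d]_q$ A$^s$MDS code whose dual $C^\perp$ is an $[n,k^\perp,d^\perp]_q$ A$^t$MDS code, with $d>1$ and $s,t\ge 1$. Then: 1. (a) If $t>1$, then $n\le s(q+1)+k-1$. (b) If $s>1$, then $k\le t(q+1)-1$. 2. If $t=1$ and $C$ has a codeword of weight $d+s+1-\alpha$ for some integer $0\le\alpha\le s+1$, then $n\le q(s+1)+k-2+\alpha$. 3. If $s=1$, then $n\le (t+1)(q+1)+k^\perp-2$, equivalently $k\le (t+1)(q+1)-2$.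 4. If $s=t=1$, $q>3$ and $k\ge 3$, then $n\le 2q+k-2$; if moreover $n>k+2$, then $k\le 2q-2$. 5. If $t=1$, then $k+s-1\le m(k-1,q)$, equivalently $n\le m(k-1,q)+k^\perp-s+1$. 6. If $s=1$, then $k^\perp+t-1\le m(k^\perp-1,q)$, equivalently $n\le m(k^\perp-1,q)+k-t+1$. 7. If $s=t=1$, then $k\le m(k-1,q)$ and $k^\perp\le m(k^\perp-1,q)$. 8. In all cases, $k\le (t+1)(q+1)-2$. -/

import Mathlib

/-- A linear `[n, k, d]` code over `F`: a `k`-dimensional subspace of `F ^ n` whose minimum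
Hamming distance between distinct codewords is `d`. -/
def IsLinearCode {F : Type*} [Field F] [DecidableEq F] {n : ℕ}
    (C : Submodule F (Fin n → F)) (k d : ℕ) : Prop :=
  Module.finrank F C = k ∧
    IsLeast {w : ℕ | ∃ x ∈ C, ∃ y ∈ C, x ≠ y ∧ hammingDist x y = w} d

/-- A code is non-degenerate if no coordinate vanishes on all codewords. -/
def IsNondegenerateCode {F : Type*} [Field F] {n : ℕ}
    (C : Submodule F (Fin n → F)) : Prop :=
  ∀ i : Fin n, ∃ x ∈ C, x i ≠ 0

/-- The dual code: all `y` with `y ⬝ x = 0` for every codeword `x`. -/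
def dualCode {F : Type*} [Field F] {n : ℕ}
    (C : Submodule F (Fin n → F)) : Submodule F (Fin n → F) where
  carrier := {y | ∀ x ∈ C, y ⬝ᵥ x = 0}
  add_mem' := by
    intro a b ha hb x hx
    rw [add_dotProduct, ha x hx, hb x hx, add_zero]
  zero_mem' := fun x _ => zero_dotProduct x
  smul_mem' := by
    intro c a ha x hx
    rw [smul_dotProduct, ha x hx, smul_zero]

/-- The Singleton defect `n - k + 1 - d` of the parameters `[n, k, d]`. -/
def singletonDefect (n k d : ℕ) : ℤ := (n : ℤ) - k + 1 - d

/-- `IsAMDSCode C s k d`: `C` is an `[n, k, d]` code of Singleton defect `s`.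
For `s = 0` these are the MDS codes. -/
def IsAMDSCode {F : Type*} [Field F] [DecidableEq F] {n : ℕ}
    (C : Submodule F (Fin n → F)) (s k d : ℕ) : Prop :=
  IsLinearCode C k d ∧ singletonDefect n k d = s

/-- `maxCodeLength F s k` is `m^s(k, q)` with `q = |F|`: the supremum (possibly `⊤`) of the lengths
of the non-degenerate `k`-dimensional codes over `F` of Singleton defect `s`. -/
noncomputable def maxCodeLength (F : Type*) [Field F] [DecidableEq F] (s k : ℕ) : ℕ∞ :=
  sSup {N : ℕ∞ | ∃ (n d : ℕ) (C : Submodule F (Fin n → F)),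
    IsNondegenerateCode C ∧ IsAMDSCode C s k d ∧ N = (n : ℕ∞)}

/-- `maxMDSLength F k` is `m(k, q)` with `q = |F|`: the maximum length of a `k`-dimensional
MDS code over `F`. -/
noncomputable def maxMDSLength (F : Type*) [Field F] [DecidableEq F] (k : ℕ) : ℕ∞ :=
  maxCodeLength F 0 k

/-! Nonzero words of `C` have at most k + s - 1 zeros and nonzero dual words have weight at least k
+ 1 - t, both bounds being attained; `HasDefects` records this. As d > 1 makes the dual code
non-degenerate, the two codes can be exchanged, and every estimate serves twice.

Pencils give the linear bounds. The words vanishing on k - 2 coordinates form a space of dimension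
at least 2, so they contain a pencil. Each coordinate outside its common zeros is a zero of exactly
one of its q + 1 members, so the cap on zeros bounds n (`card_add_mul_card_le`). If t > 1, a dual
word of small weight forces one more common zero and sharpens the bound.

If t = 1, any k - 1 coordinates are independent on `C`. Restricting `C` to the zeros of a minimum
weight word therefore kills only the multiples of that word and leaves an MDS code of dimension k -
1 and length k + s - 1, so k + s - 1 ≤ m(k - 1, q).

If s = t = 1, shortening to dimension 3 turns the remaining coordinates into n - k + 3 points of a
projective plane, at most three on a line. By `IsThreeArc.card_le_two_mul_add_one` there are at most
2q + 1 of them when q > 3; this is the deep part. Given 2q + 2 such points, each is on exactly one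
bisecant. Counting bisecants through points off the arc modulo 6 forces 3 ∣ q, and then all
bisecants concur. Adding their common point gives 2q + 3 points that every line meets in 0 or 3. A
product over these points yields a Ceva relation for triangles of the arc. In characteristic three
this relation splits the arc into affine planes of order three, so 9 divides 2q + 3, which is
impossible because 9 divides q. -/

/-- Double counting of the zeros of the functions in the pencil spanned by `g` and `h`. -/
theorem card_add_card_mul_card_common_zeros {F ι : Type*} [Field F] [Fintype F] [DecidableEq F]
    [Fintype ι] (g h : ι → F) :
    Fintype.card ι + Fintype.card F * (Finset.univ.filter fun i => g i = 0 ∧ h i = 0).card =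
      (Finset.univ.filter fun i => h i = 0).card +
        ∑ c : F, (Finset.univ.filter fun i => g i + c * h i = 0).card := by
  have key : ∀ i : ι, (∑ c : F, if g i + c * h i = 0 then 1 else 0) =
      (if h i = 0 then 0 else 1) + Fintype.card F * (if g i = 0 ∧ h i = 0 then 1 else 0) := by
    intro i
    by_cases hi : h i = 0
    · by_cases hg : g i = 0 <;> simp [hi, hg]
    · have : ∀ c : F, g i + c * h i = 0 ↔ c = -g i / h i := by
        intro c
        rw [eq_div_iff hi]
        constructor <;> intro H <;> linear_combination H
      simp [hi, this]
  simp only [Finset.card_filter]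
  rw [Finset.sum_comm]
  simp only [key, Finset.sum_add_distrib, ← Finset.mul_sum]
  rw [← add_assoc, ← Finset.sum_add_distrib]
  congr 1
  rw [← Finset.card_univ, Finset.card_eq_sum_ones]
  refine Finset.sum_congr rfl fun i _ => ?_
  split_ifs <;> rfl

open Matrix

/-! ### Cross products as incidence in the projective plane; arcs with at most three points on a
line. -/

section Arcs

variable {F : Type*} [Field F]

theorem exists_smul_of_cross_eq_zero {u w : Fin 3 → F} (hu : u ≠ 0) (h : u ⨯₃ w = 0) :
    ∃ c : F, w = c • u := by
  have h0 := congrFun h 0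
  have h1 := congrFun h 1
  have h2 := congrFun h 2
  simp only [cross_apply, Matrix.cons_val_zero, Matrix.cons_val_one, Matrix.cons_val,
    Pi.zero_apply] at h0 h1 h2
  obtain ⟨i, hi⟩ := Function.ne_iff.mp hu
  rw [Pi.zero_apply] at hi
  refine ⟨w i / u i, ?_⟩
  funext j
  simp only [Pi.smul_apply, smul_eq_mul]
  rw [div_mul_eq_mul_div, eq_div_iff hi]
  fin_cases i <;> fin_cases j <;> simp only [Fin.mk_one, Fin.zero_eta, Fin.reduceFinMk] <;>
    first
    | ring1
    | linear_combination h0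
    | linear_combination -h0
    | linear_combination h1
    | linear_combination -h1
    | linear_combination h2
    | linear_combination -h2

/-- If `u` and `w` were independent, the vector triple product would make both `x` and `y` multiples
of `u ⨯₃ w`. -/
theorem cross_eq_zero_of_dot_eq_zero {x y u w : Fin 3 → F} (hxy : x ⨯₃ y ≠ 0)
    (hxu : x ⬝ᵥ u = 0) (hyu : y ⬝ᵥ u = 0) (hxw : x ⬝ᵥ w = 0) (hyw : y ⬝ᵥ w = 0) :
    u ⨯₃ w = 0 := by
  by_contra hne
  refine hxy ?_
  have e1 : (u ⨯₃ w) ⨯₃ x = 0 := by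
    rw [cross_cross_eq_smul_sub_smul]
    rw [dotProduct_comm u x, dotProduct_comm w x, hxu, hxw]; simp
  have e2 : (u ⨯₃ w) ⨯₃ y = 0 := by
    rw [cross_cross_eq_smul_sub_smul]
    rw [dotProduct_comm u y, dotProduct_comm w y, hyu, hyw]; simp
  obtain ⟨c, rfl⟩ := exists_smul_of_cross_eq_zero hne e1
  obtain ⟨d, rfl⟩ := exists_smul_of_cross_eq_zero hne e2
  simp

/-- Every nonzero `x` orthogonal to `u` extends to a basis of the plane orthogonal to `u`. -/
theorem exists_cross_ne_zero_of_dot_eq_zero {x u : Fin 3 → F} (hx : x ≠ 0) (hu : u ≠ 0)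
    (hxu : x ⬝ᵥ u = 0) : ∃ y : Fin 3 → F, y ⬝ᵥ u = 0 ∧ y ⨯₃ x ≠ 0 := by
  obtain ⟨i, hi⟩ := Function.ne_iff.mp hx
  -- With `x` orthogonal to `u`, the triple product formula gives (u × eᵢ) × x = -xᵢ u, which is
  -- nonzero.
  refine ⟨u ⨯₃ Pi.single i 1, by rw [dotProduct_comm, dot_self_cross], ?_⟩
  rw [cross_cross_eq_smul_sub_smul, dotProduct_comm u x, hxu]
  simpa [hu] using hi

theorem add_smul_ne_zero_of_cross_ne_zero {x y : Fin 3 → F} (h : x ⨯₃ y ≠ 0) (c : F) :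
    x + c • y ≠ 0 := by
  intro h0
  rw [eq_neg_of_add_eq_zero_left h0] at h
  simp at h

variable {ι : Type*} [Fintype ι] [DecidableEq F]

/-- The indices of the points of the family `v` that lie on the line `x`. -/
def pointsOn (v : ι → Fin 3 → F) (x : Fin 3 → F) : Finset ι :=
  Finset.univ.filter fun m => x ⬝ᵥ v m = 0

theorem mem_pointsOn {v : ι → Fin 3 → F} {x : Fin 3 → F} {m : ι} :
    m ∈ pointsOn v x ↔ x ⬝ᵥ v m = 0 := by
  simp [pointsOn]

theorem pointsOn_smul (v : ι → Fin 3 → F) (x : Fin 3 → F) {c : F} (hc : c ≠ 0) :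
    pointsOn v (c • x) = pointsOn v x := by
  ext m
  simp [mem_pointsOn, hc]

/-- A family of distinct points of the projective plane over `F`, at most three on a line. -/
structure IsThreeArc (v : ι → Fin 3 → F) : Prop where
  ne_zero : ∀ i, v i ≠ 0
  cross_ne_zero : ∀ i j, i ≠ j → v i ⨯₃ v j ≠ 0
  card_le : ∀ x, x ≠ 0 → (pointsOn v x).card ≤ 3

namespace IsThreeArc

variable {v : ι → Fin 3 → F}

theorem eq_of_mem_of_mem (hv : IsThreeArc v) {x y : Fin 3 → F} (hxy : x ⨯₃ y ≠ 0) {i m : ι}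
    (hix : i ∈ pointsOn v x) (hiy : i ∈ pointsOn v y) (hmx : m ∈ pointsOn v x)
    (hmy : m ∈ pointsOn v y) : m = i := by
  rw [mem_pointsOn] at *
  by_contra h
  exact hv.cross_ne_zero m i h (cross_eq_zero_of_dot_eq_zero hxy hmx hmy hix hiy)

variable [Fintype F]

/-- The lines through a point of the arc partition the remaining points. -/
theorem card_add_card (hv : IsThreeArc v) {x y : Fin 3 → F} (hxy : x ⨯₃ y ≠ 0) {i : ι}
    (hix : i ∈ pointsOn v x) (hiy : i ∈ pointsOn v y) :
    Fintype.card ι + Fintype.card F =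
      (pointsOn v y).card + ∑ c : F, (pointsOn v (x + c • y)).card := by
  have h := card_add_card_mul_card_common_zeros (fun m => x ⬝ᵥ v m) (fun m => y ⬝ᵥ v m)
  have h1 : (Finset.univ.filter fun m => x ⬝ᵥ v m = 0 ∧ y ⬝ᵥ v m = 0) = {i} := by
    ext m
    simp only [Finset.mem_filter, Finset.mem_univ, true_and, Finset.mem_singleton]
    rw [← mem_pointsOn, ← mem_pointsOn]
    exact ⟨fun H => hv.eq_of_mem_of_mem hxy hix hiy H.1 H.2, by rintro rfl; exact ⟨hix, hiy⟩⟩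
  rw [h1, Finset.card_singleton, mul_one] at h
  rw [h]
  simp only [pointsOn, add_dotProduct, smul_dotProduct, smul_eq_mul]

/-- Each of the q other lines through the point carries at most two further points. -/
theorem card_le_card_pointsOn_add (hv : IsThreeArc v) {x : Fin 3 → F} (hx : x ≠ 0) {i : ι}
    (hi : i ∈ pointsOn v x) : Fintype.card ι ≤ (pointsOn v x).card + 2 * Fintype.card F := by
  obtain ⟨y, hyi, hyx⟩ :=
    exists_cross_ne_zero_of_dot_eq_zero hx (hv.ne_zero i) (mem_pointsOn.mp hi)
  have h := hv.card_add_card hyx (mem_pointsOn.mpr hyi) hi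
  have h3 : ∑ c : F, (pointsOn v (y + c • x)).card ≤ ∑ _c : F, 3 :=
    Finset.sum_le_sum fun c _ => hv.card_le _ (add_smul_ne_zero_of_cross_ne_zero hyx c)
  simp only [Finset.sum_const, Finset.card_univ, smul_eq_mul] at h3
  omega

end IsThreeArc
end Arcs

/-- If the sets `S i` partition `T` into classes of size `k`, then `k` divides `T.card`. -/
theorem dvd_card_of_forall_mem_class {ι : Type*} [DecidableEq ι] {k : ℕ} (T : Finset ι)
    (S : ι → Finset ι) (hmem : ∀ i ∈ T, i ∈ S i) (hcard : ∀ i ∈ T, (S i).card = k)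
    (hsub : ∀ i ∈ T, S i ⊆ T) (heq : ∀ i ∈ T, ∀ j ∈ S i, S j = S i) : k ∣ T.card := by
  rw [Finset.card_eq_sum_card_image S T]
  refine Finset.dvd_sum fun b hb => ?_
  obtain ⟨i, hi, rfl⟩ := Finset.mem_image.mp hb
  have : (T.filter fun a => S a = S i) = S i := by
    ext j
    rw [Finset.mem_filter]
    exact ⟨fun h => h.2 ▸ hmem j h.1, fun h => ⟨hsub i hi h, heq i hi j h⟩⟩
  rw [this, hcard i hi]

/-! ### Arcs of 2q + 2 points: bisecants and their count modulo 6. -/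

section Arcs

variable {F : Type*} [Field F]

theorem cross_comm_eq_zero {x y : Fin 3 → F} : x ⨯₃ y = 0 ↔ y ⨯₃ x = 0 := by
  rw [← cross_anticomm, neg_eq_zero]

theorem dot_eq_zero_of_cross_eq_zero {x y p : Fin 3 → F} (hx : x ≠ 0)
    (h : x ⨯₃ y = 0) (hp : x ⬝ᵥ p = 0) : y ⬝ᵥ p = 0 := by
  obtain ⟨c, rfl⟩ := exists_smul_of_cross_eq_zero hx h
  rw [smul_dotProduct, hp, smul_zero]

variable [DecidableEq F] {ι : Type*} [Fintype ι]

theorem pointsOn_eq_of_cross_eq_zero (v : ι → Fin 3 → F) {x y : Fin 3 → F} (hx : x ≠ 0)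
    (hy : y ≠ 0) (h : x ⨯₃ y = 0) : pointsOn v x = pointsOn v y := by
  obtain ⟨c, rfl⟩ := exists_smul_of_cross_eq_zero hx h
  rw [pointsOn_smul v x (left_ne_zero_of_smul hy)]

namespace IsThreeArc

variable {v : ι → Fin 3 → F} [Fintype F]

theorem two_le_card_pointsOn (hv : IsThreeArc v) (hn : Fintype.card ι = 2 * Fintype.card F + 2)
    {x : Fin 3 → F} (hx : x ≠ 0) {i : ι} (hi : i ∈ pointsOn v x) : 2 ≤ (pointsOn v x).card := by
  have := hv.card_le_card_pointsOn_add hx hi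
  omega

/-- If all q + 1 lines through the point held two further points, there would be 2q + 3 points in
all. -/
theorem exists_bisecant (hv : IsThreeArc v) (hn : Fintype.card ι = 2 * Fintype.card F + 2)
    (i : ι) : ∃ x : Fin 3 → F, x ≠ 0 ∧ i ∈ pointsOn v x ∧ (pointsOn v x).card = 2 := by
  by_contra! H
  have h3 : ∀ x : Fin 3 → F, x ≠ 0 → i ∈ pointsOn v x → (pointsOn v x).card = 3 := by
    intro x hx hi
    have h1 := hv.two_le_card_pointsOn hn hx hi
    have h2 := hv.card_le x hx
    have h4 := H x hx hi
    omega
  have : Nontrivial ι := Fintype.one_lt_card_iff_nontrivial.mp (by omega)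
  obtain ⟨j, hj⟩ := exists_ne i
  have hx := hv.cross_ne_zero i j hj.symm
  have hxi : v i ⨯₃ v j ⬝ᵥ v i = 0 := by rw [dotProduct_comm, dot_self_cross]
  obtain ⟨y, hyi, hyx⟩ := exists_cross_ne_zero_of_dot_eq_zero hx (hv.ne_zero i) hxi
  have h := hv.card_add_card hyx (mem_pointsOn.mpr hyi) (mem_pointsOn.mpr hxi)
  have hsum : ∀ c : F, (pointsOn v (y + c • (v i ⨯₃ v j))).card = 3 := fun c =>
    h3 _ (add_smul_ne_zero_of_cross_ne_zero hyx c) (by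
      rw [mem_pointsOn, add_dotProduct, smul_dotProduct, hyi, hxi]; simp)
  rw [h3 _ hx (mem_pointsOn.mpr hxi), Finset.sum_congr rfl fun c _ => hsum c] at h
  simp only [Finset.sum_const, Finset.card_univ, smul_eq_mul] at h
  omega

/-- Two bisecants through a point would leave room for at most 1 + 1 + 1 + 2(q - 1) = 2q + 1 points.
-/
theorem bisecant_unique (hv : IsThreeArc v) (hn : Fintype.card ι = 2 * Fintype.card F + 2)
    {i : ι} {x y : Fin 3 → F} (hi : i ∈ pointsOn v x) (hx : (pointsOn v x).card = 2)
    (hi' : i ∈ pointsOn v y) (hy : (pointsOn v y).card = 2) : x ⨯₃ y = 0 := by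
  by_contra hxy
  have h := hv.card_add_card hxy hi hi'
  have h3 : ∑ c : F, (pointsOn v (x + c • y)).card < ∑ _c : F, 3 := by
    refine Finset.sum_lt_sum
      (fun c _ => hv.card_le _ (add_smul_ne_zero_of_cross_ne_zero hxy c)) ⟨0, Finset.mem_univ _, ?_⟩
    simp [hx]
  simp only [Finset.sum_const, Finset.card_univ, smul_eq_mul] at h3
  omega

end IsThreeArc

/-- `l i` is the unique line through the `i`-th point of the arc `v` containing exactly two
points. -/
structure IsBisecantFamily (v l : ι → Fin 3 → F) : Prop where
  ne_zero : ∀ i, l i ≠ 0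
  mem : ∀ i, i ∈ pointsOn v (l i)
  card_eq : ∀ i, (pointsOn v (l i)).card = 2
  unique : ∀ i x, i ∈ pointsOn v x → (pointsOn v x).card = 2 → l i ⨯₃ x = 0

namespace IsBisecantFamily

variable {v l : ι → Fin 3 → F}

theorem cross_eq_zero (hl : IsBisecantFamily v l) {i j : ι} (h : j ∈ pointsOn v (l i)) :
    l j ⨯₃ l i = 0 := hl.unique j _ h (hl.card_eq i)

theorem pointsOn_eq (hl : IsBisecantFamily v l) {i j : ι} (h : j ∈ pointsOn v (l i)) :
    pointsOn v (l j) = pointsOn v (l i) :=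
  pointsOn_eq_of_cross_eq_zero v (hl.ne_zero j) (hl.ne_zero i) (hl.cross_eq_zero h)

theorem mem_comm (hl : IsBisecantFamily v l) {i j : ι} (h : j ∈ pointsOn v (l i)) :
    i ∈ pointsOn v (l j) := hl.pointsOn_eq h ▸ hl.mem i

theorem pointsOn_point (hl : IsBisecantFamily v l) (i : ι) :
    pointsOn l (v i) = pointsOn v (l i) := by
  ext m
  rw [mem_pointsOn, dotProduct_comm, ← mem_pointsOn]
  exact ⟨hl.mem_comm, hl.mem_comm⟩

/-- Bisecants are indexed by arc points, so each one is counted twice, once for each of its two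
points. -/
theorem two_dvd_card [DecidableEq ι] (hl : IsBisecantFamily v l) (p : Fin 3 → F) :
    2 ∣ (pointsOn l p).card := by
  refine dvd_card_of_forall_mem_class _ (fun i => pointsOn v (l i)) (fun i _ => hl.mem i)
    (fun i _ => hl.card_eq i) (fun i hi j hj => ?_) (fun i _ j hj => hl.pointsOn_eq hj)
  rw [mem_pointsOn, dotProduct_comm] at hi ⊢
  exact dot_eq_zero_of_cross_eq_zero (hl.ne_zero i) (cross_comm_eq_zero.mp (hl.cross_eq_zero hj)) hi

/-- A line through `p` that meets the arc has two or three of its points. The indices whose bisecant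
misses `p` are those on the lines with three, so these lines cut them into triples. -/
theorem three_dvd_card_compl [Fintype F] [DecidableEq ι] (hl : IsBisecantFamily v l)
    (hv : IsThreeArc v)
    (hn : Fintype.card ι = 2 * Fintype.card F + 2) {p : Fin 3 → F} (hp : ∀ m, p ⨯₃ v m ≠ 0) :
    3 ∣ (pointsOn l p)ᶜ.card := by
  have hpar : ∀ i j, j ∈ pointsOn v (p ⨯₃ v i) → (p ⨯₃ v j) ⨯₃ (p ⨯₃ v i) = 0 := by
    intro i j hj
    refine cross_eq_zero_of_dot_eq_zero (hp j) ?_ ?_ ?_ ?_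
    · rw [dot_self_cross]
    · rw [dot_cross_self]
    · rw [dot_self_cross]
    · rw [dotProduct_comm]; exact mem_pointsOn.mp hj
  have hmem : ∀ i, i ∈ pointsOn v (p ⨯₃ v i) := fun i => by
    rw [mem_pointsOn, dotProduct_comm, dot_cross_self]
  refine dvd_card_of_forall_mem_class _ (fun i => pointsOn v (p ⨯₃ v i)) (fun i _ => hmem i)
    (fun i hi => ?_) (fun i hi j hj => ?_)
    (fun i _ j hj => pointsOn_eq_of_cross_eq_zero v (hp j) (hp i) (hpar i j hj))
  · have h1 := hv.two_le_card_pointsOn hn (hp i) (hmem i)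
    have h2 := hv.card_le _ (hp i)
    have h3 : (pointsOn v (p ⨯₃ v i)).card ≠ 2 := by
      intro h
      have h4 := hl.unique i _ (hmem i) h
      rw [Finset.mem_compl, mem_pointsOn, dotProduct_comm] at hi
      refine hi (dot_eq_zero_of_cross_eq_zero (hp i) (cross_comm_eq_zero.mp h4) ?_)
      rw [dotProduct_comm, dot_self_cross]
    omega
  · rw [Finset.mem_compl, mem_pointsOn, dotProduct_comm] at hi ⊢
    intro h0
    refine hi ?_
    have h1 : l j ⨯₃ (p ⨯₃ v j) = 0 := by
      refine cross_eq_zero_of_dot_eq_zero (hp j) ?_ ?_ ?_ ?_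
      · rw [dotProduct_comm]; exact h0
      · rw [dotProduct_comm]; exact mem_pointsOn.mp (hl.mem j)
      · rw [dot_self_cross]
      · rw [dot_cross_self]
    have h2 : pointsOn v (l j) = pointsOn v (p ⨯₃ v i) := by
      rw [pointsOn_eq_of_cross_eq_zero v (hl.ne_zero j) (hp j) h1,
        pointsOn_eq_of_cross_eq_zero v (hp j) (hp i) (hpar i j hj)]
    have h3 : i ∈ pointsOn v (l j) := h2 ▸ hmem i
    exact dot_eq_zero_of_cross_eq_zero (hl.ne_zero j)
      (cross_comm_eq_zero.mp (hl.cross_eq_zero h3)) h0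

theorem card_pointsOn_mod_six [Fintype F] [DecidableEq ι] (hl : IsBisecantFamily v l)
    (hv : IsThreeArc v)
    (hn : Fintype.card ι = 2 * Fintype.card F + 2) {p : Fin 3 → F} (hp : ∀ m, p ⨯₃ v m ≠ 0) :
    (pointsOn l p).card % 6 = (2 * Fintype.card F + 2) % 6 := by
  have h1 := hl.three_dvd_card_compl hv hn hp
  have h2 := hl.two_dvd_card p
  have h3 := Finset.card_compl_add_card (pointsOn l p)
  omega

/-- The count of bisecants meeting a fixed bisecant outside the arc. -/
theorem sum_card_pointsOn [Fintype F] [DecidableEq ι] (hl : IsBisecantFamily v l)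
    {i j : ι} (hj : j ∈ pointsOn v (l i)) :
    Fintype.card ι + 2 * Fintype.card F =
      4 + ∑ c ∈ Finset.univ.erase (0 : F), (pointsOn l (v j + c • v i)).card := by
  have h := card_add_card_mul_card_common_zeros (fun m => v j ⬝ᵥ l m) (fun m => v i ⬝ᵥ l m)
  have hB : ∀ m, (Finset.univ.filter fun a => v m ⬝ᵥ l a = 0) = pointsOn v (l m) := fun m =>
    hl.pointsOn_point m
  have h1 : (Finset.univ.filter fun m => v j ⬝ᵥ l m = 0 ∧ v i ⬝ᵥ l m = 0) = pointsOn v (l i) := by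
    rw [Finset.filter_and, hB, hB, hl.pointsOn_eq hj, Finset.inter_self]
  -- The pencil consists of the points of the line joining `v i` and `v j`. Each of these two lies
  -- on no other bisecant and counts 2, which is the 4 of the statement.
  rw [h1, hB, hl.card_eq, ← Finset.add_sum_erase _ _ (Finset.mem_univ (0 : F))] at h
  simp only [zero_mul, add_zero] at h
  rw [hB, hl.card_eq] at h
  simp only [pointsOn, add_dotProduct, smul_dotProduct, smul_eq_mul] at h ⊢
  omega

end IsBisecantFamily
end Arcs

/-! ### The order is a multiple of three, and the bisecants are concurrent. -/

section Arcs

variable {F : Type*} [Field F] [DecidableEq F] {ι : Type*} [Fintype ι]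

namespace IsBisecantFamily

variable {v l : ι → Fin 3 → F}

theorem eq_or_eq_of_mem [DecidableEq ι] (hl : IsBisecantFamily v l) {i j m : ι}
    (hj : j ∈ pointsOn v (l i))
    (hij : j ≠ i) (hm : m ∈ pointsOn v (l i)) : m = i ∨ m = j := by
  have h : ({i, j} : Finset ι) = pointsOn v (l i) := by
    refine Finset.eq_of_subset_of_card_le ?_ (by rw [hl.card_eq, Finset.card_pair hij.symm])
    intro a ha
    rcases Finset.mem_insert.mp ha with rfl | ha
    · exact hl.mem a
    · rwa [Finset.mem_singleton.mp ha]
  rw [← h] at hm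
  simpa using hm

theorem cross_ne_zero_of_mem [DecidableEq ι] (hl : IsBisecantFamily v l) (hv : IsThreeArc v)
    {i j : ι} (hj : j ∈ pointsOn v (l i)) (hij : j ≠ i) {c : F} (hc : c ≠ 0) (m : ι) :
    (v j + c • v i) ⨯₃ v m ≠ 0 := by
  intro h
  have h0 := add_smul_ne_zero_of_cross_ne_zero (hv.cross_ne_zero j i hij) c
  have h1 : v m ⬝ᵥ l i = 0 := by
    refine dot_eq_zero_of_cross_eq_zero h0 h ?_
    rw [dotProduct_comm, dotProduct_add, dotProduct_smul, mem_pointsOn.mp hj,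
      mem_pointsOn.mp (hl.mem i)]
    simp
  rw [dotProduct_comm, ← mem_pointsOn] at h1
  rcases hl.eq_or_eq_of_mem hj hij h1 with rfl | rfl
  · simp only [map_add, map_smul, LinearMap.add_apply, LinearMap.smul_apply, cross_self,
      smul_zero, add_zero] at h
    exact hv.cross_ne_zero _ _ hij h
  · simp only [map_add, map_smul, LinearMap.add_apply, LinearMap.smul_apply, cross_self,
      zero_add, smul_eq_zero, hc, false_or] at h
    exact hv.cross_ne_zero _ _ hij.symm h

theorem exists_ne_mem [DecidableEq ι] (hl : IsBisecantFamily v l) (i : ι) :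
    ∃ j ∈ pointsOn v (l i), j ≠ i :=
  Finset.exists_mem_ne (by rw [hl.card_eq]; norm_num) i

/-- On a fixed bisecant the counts at the q - 1 points off the arc add up to 4q - 2, and each is 2q
+ 2 modulo 6. For q ≡ 1 mod 3 the sum has the wrong residue modulo 3; for q ≡ 2 each count is a
positive multiple of 6, making the sum too large. -/
theorem three_dvd_card_field [Fintype F] [DecidableEq ι] (hl : IsBisecantFamily v l)
    (hv : IsThreeArc v)
    (hn : Fintype.card ι = 2 * Fintype.card F + 2) (hq : 3 < Fintype.card F) :
    3 ∣ Fintype.card F := by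
  have : Nonempty ι := Fintype.card_pos_iff.mp (by omega)
  let i : ι := Classical.arbitrary ι
  obtain ⟨j, hj, hij⟩ := hl.exists_ne_mem i
  have hsum := hl.sum_card_pointsOn hj
  have hmod : ∀ c ∈ Finset.univ.erase (0 : F), (pointsOn l (v j + c • v i)).card % 6 =
      (2 * Fintype.card F + 2) % 6 := fun c hc =>
    hl.card_pointsOn_mod_six hv hn (hl.cross_ne_zero_of_mem hv hj hij (Finset.ne_of_mem_erase hc))
  have hcard : (Finset.univ.erase (0 : F)).card = Fintype.card F - 1 := by
    rw [Finset.card_erase_of_mem (Finset.mem_univ _), Finset.card_univ]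
  have h3 : ∀ c ∈ Finset.univ.erase (0 : F), (pointsOn l (v j + c • v i)).card ≥ 2 := by
    intro c hc
    rw [← hl.card_eq i]
    refine Finset.card_le_card fun m hm => ?_
    rw [mem_pointsOn, add_dotProduct, smul_dotProduct]
    have h1 : v i ⬝ᵥ l m = 0 := mem_pointsOn.mp ((hl.pointsOn_point i).symm ▸ hm)
    have h2 : v j ⬝ᵥ l m = 0 := mem_pointsOn.mp
      ((hl.pointsOn_point j).symm ▸ (hl.pointsOn_eq hj).symm ▸ hm)
    simp [h1, h2]
  by_contra hdvd
  rcases (by omega : Fintype.card F % 3 = 1 ∨ Fintype.card F % 3 = 2) with h | h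
  · have e : (∑ c ∈ Finset.univ.erase (0 : F), (pointsOn l (v j + c • v i)).card) % 3 =
        (∑ c ∈ Finset.univ.erase (0 : F), 1) % 3 := by
      rw [Finset.sum_nat_mod, Finset.sum_nat_mod _ _ (fun _ => 1)]
      congr 1
      refine Finset.sum_congr rfl fun c hc => ?_
      have := hmod c hc
      omega
    simp only [Finset.sum_const, hcard, smul_eq_mul] at e
    omega
  · have e : ∑ c ∈ Finset.univ.erase (0 : F), 6 ≤
        ∑ c ∈ Finset.univ.erase (0 : F), (pointsOn l (v j + c • v i)).card := by
      refine Finset.sum_le_sum fun c hc => ?_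
      have := hmod c hc
      have := h3 c hc
      omega
    simp only [Finset.sum_const, hcard, smul_eq_mul] at e
    omega

theorem two_le_card_pointsOn [Fintype F] [DecidableEq ι] (hl : IsBisecantFamily v l)
    (hv : IsThreeArc v) (hn : Fintype.card ι = 2 * Fintype.card F + 2)
    (hq : 3 ∣ Fintype.card F) {p : Fin 3 → F} (hp : p ≠ 0) : 2 ≤ (pointsOn l p).card := by
  by_cases h : ∃ m, p ⨯₃ v m = 0
  · obtain ⟨m, hm⟩ := h
    rw [pointsOn_eq_of_cross_eq_zero l hp (hv.ne_zero m) hm, hl.pointsOn_point, hl.card_eq]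
  · push Not at h
    have := hl.card_pointsOn_mod_six hv hn h
    omega

/-- In characteristic three the bisecants are concurrent. -/
theorem exists_nucleus [Fintype F] [DecidableEq ι] (hl : IsBisecantFamily v l)
    (hv : IsThreeArc v)
    (hn : Fintype.card ι = 2 * Fintype.card F + 2) (hq : 3 ∣ Fintype.card F) :
    ∃ p : Fin 3 → F, (∀ m, p ⨯₃ v m ≠ 0) ∧ ∀ m, l m ⬝ᵥ p = 0 := by
  have : Nonempty ι := Fintype.card_pos_iff.mp (by omega)
  let i : ι := Classical.arbitrary ι
  have hcard : (Finset.univ.erase (0 : F)).card = Fintype.card F - 1 := by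
    rw [Finset.card_erase_of_mem (Finset.mem_univ _), Finset.card_univ]
  have hq1 : 1 < Fintype.card F := Fintype.one_lt_card
  obtain ⟨j, hj, hij⟩ := hl.exists_ne_mem i
  -- The q - 1 counts sum to 4q - 2 > 2(q - 1), so some point of this bisecant lies on another one.
  obtain ⟨c, hc, hc2⟩ : ∃ c ∈ Finset.univ.erase (0 : F),
      2 < (pointsOn l (v j + c • v i)).card := by
    by_contra! H
    have h1 := Finset.sum_le_sum H
    have h2 := hl.sum_card_pointsOn hj
    simp only [Finset.sum_const, hcard, smul_eq_mul] at h1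
    omega
  have hoff := hl.cross_ne_zero_of_mem hv hj hij (Finset.ne_of_mem_erase hc)
  set p := v j + c • v i
  refine ⟨p, hoff, fun m => ?_⟩
  -- If bisecant `l m` missed `p`, no bisecant would contain both `p` and `v m`. Each point of their
  -- joining line has count at least 2, and `p` has more, so the total would exceed 2q + 2.
  by_contra hm
  have h := card_add_card_mul_card_common_zeros (fun a => p ⬝ᵥ l a) (fun a => v m ⬝ᵥ l a)
  have hB : (Finset.univ.filter fun a => v m ⬝ᵥ l a = 0) = pointsOn v (l m) :=
    hl.pointsOn_point m
  have h1 : (Finset.univ.filter fun a => p ⬝ᵥ l a = 0 ∧ v m ⬝ᵥ l a = 0) = ∅ := by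
    rw [Finset.filter_and, hB, ← Finset.not_nonempty_iff_eq_empty]
    rintro ⟨a, ha⟩
    obtain ⟨ha1, ha2⟩ := Finset.mem_inter.mp ha
    rw [Finset.mem_filter, dotProduct_comm] at ha1
    exact hm (dot_eq_zero_of_cross_eq_zero (hl.ne_zero a) (hl.cross_eq_zero ha2) ha1.2)
  rw [h1, hB, hl.card_eq, ← Finset.add_sum_erase _ _ (Finset.mem_univ (0 : F))] at h
  have h2 : ∑ c ∈ Finset.univ.erase (0 : F), 2 ≤
      ∑ c ∈ Finset.univ.erase (0 : F), (pointsOn l (p + c • v m)).card :=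
    Finset.sum_le_sum fun c _ => hl.two_le_card_pointsOn hv hn hq
      (add_smul_ne_zero_of_cross_ne_zero (hoff m) c)
  simp only [Finset.sum_const, hcard, smul_eq_mul] at h2
  simp only [zero_mul, add_zero, Finset.card_empty, mul_zero] at h
  simp only [pointsOn, add_dotProduct, smul_dotProduct, smul_eq_mul] at h h2 hc2
  omega

end IsBisecantFamily

namespace IsThreeArc

variable {v : ι → Fin 3 → F} [Fintype F]

/-- A three-arc with `2 * q + 2` points in a plane of order `q > 3` is contained in one with
`2 * q + 3` points, and `q` is a multiple of three. -/
theorem exists_extension (hv : IsThreeArc v)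
    (hn : Fintype.card ι = 2 * Fintype.card F + 2) (hq : 3 < Fintype.card F) :
    3 ∣ Fintype.card F ∧ ∃ w : Option ι → Fin 3 → F, IsThreeArc w := by
  let _ : DecidableEq ι := Classical.decEq ι
  choose l hl0 hlm hl2 using hv.exists_bisecant hn
  have hl : IsBisecantFamily v l := ⟨hl0, hlm, hl2, fun i x hi hx =>
    hv.bisecant_unique hn (hlm i) (hl2 i) hi hx⟩
  have h3 := hl.three_dvd_card_field hv hn hq
  refine ⟨h3, ?_⟩
  obtain ⟨p, hp, hlp⟩ := hl.exists_nucleus hv hn h3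
  have : Nonempty ι := Fintype.card_pos_iff.mp (by omega)
  refine ⟨fun o => o.elim p v, ?_, ?_, ?_⟩
  · rintro (_ | i)
    · rintro (rfl : p = 0)
      simpa using hp (Classical.arbitrary ι)
    · exact hv.ne_zero i
  · rintro (_ | i) (_ | j) hij
    · exact absurd rfl hij
    · exact hp j
    · exact fun h => hp i (cross_comm_eq_zero.mp h)
    · exact hv.cross_ne_zero i j fun h => hij (congrArg some h)
  · intro x hx
    have hcard : (pointsOn (fun o : Option ι => o.elim p v) x).card =
        (if x ⬝ᵥ p = 0 then 1 else 0) + (pointsOn v x).card := by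
      simp only [pointsOn, Finset.card_filter, Fintype.sum_option, Option.elim_none,
        Option.elim_some]
      rfl
    rw [hcard]
    split_ifs with hxp
    · rcases (pointsOn v x).eq_empty_or_nonempty with h | ⟨i, hi⟩
      · simp [h]
      · have h1 : x ⨯₃ l i = 0 := by
          refine cross_eq_zero_of_dot_eq_zero (hp i) ?_ ?_ ?_ ?_
          · rw [dotProduct_comm, hxp]
          · rw [dotProduct_comm]; exact mem_pointsOn.mp hi
          · rw [dotProduct_comm, hlp]
          · rw [dotProduct_comm]; exact mem_pointsOn.mp (hlm i)
        rw [pointsOn_eq_of_cross_eq_zero v hx (hl0 i) h1, hl2]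
    · rw [zero_add]
      exact hv.card_le x hx

end IsThreeArc
end Arcs

/-! ### Maximal arcs of degree three and Ceva's condition. -/

section MaximalArcs

variable {F : Type*} [Field F]

theorem exists_smul_add_smul_of_dot_cross_eq_zero {p r w : Fin 3 → F} (h : p ⨯₃ r ≠ 0)
    (hw : w ⬝ᵥ p ⨯₃ r = 0) : ∃ a b : F, w = a • p + b • r := by
  have h1 : (p ⨯₃ r) ⨯₃ (p ⨯₃ w) = 0 := by
    have h2 : (p ⨯₃ r) ⨯₃ (p ⨯₃ w) = (w ⬝ᵥ p ⨯₃ r) • p := by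
      funext i
      fin_cases i <;>
        simp [cross_apply, dotProduct, Fin.sum_univ_three] <;> ring
    rw [h2, hw, zero_smul]
  obtain ⟨b, hb⟩ := exists_smul_of_cross_eq_zero h h1
  have hp : p ≠ 0 := by
    rintro rfl
    simp at h
  obtain ⟨a, ha⟩ := exists_smul_of_cross_eq_zero (u := p) (w := w - b • r) hp (by
    rw [map_sub, map_smul, hb, sub_self])
  exact ⟨a, b, by rw [← ha]; abel⟩

/-- Inversion permutes the nonzero elements, so their product equals its own inverse. -/
theorem prod_sq_erase_zero [Fintype F] [DecidableEq F] :
    ∏ b ∈ Finset.univ.erase (0 : F), b ^ 2 = 1 := by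
  have h : ∏ b ∈ Finset.univ.erase (0 : F), b = ∏ b ∈ Finset.univ.erase (0 : F), b⁻¹ := by
    refine Finset.prod_nbij' Inv.inv Inv.inv ?_ ?_ ?_ ?_ ?_ <;> simp
  have h2 : ∏ b ∈ Finset.univ.erase (0 : F), b ^ 2 =
      (∏ b ∈ Finset.univ.erase (0 : F), b) * ∏ b ∈ Finset.univ.erase (0 : F), b⁻¹ := by
    rw [← h, Finset.prod_pow, sq]
  rw [h2, ← Finset.prod_mul_distrib]
  exact Finset.prod_eq_one fun b hb => mul_inv_cancel₀ (Finset.ne_of_mem_erase hb)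

variable [DecidableEq F] {ι : Type*} [Fintype ι]

/-- A maximal arc of degree three: every line that meets it has exactly three of its points. -/
structure IsMaximalThreeArc (v : ι → Fin 3 → F) : Prop extends IsThreeArc v where
  card_eq : ∀ x i, x ≠ 0 → i ∈ pointsOn v x → (pointsOn v x).card = 3

theorem IsThreeArc.isMaximalThreeArc [Fintype F] {v : ι → Fin 3 → F} (hv : IsThreeArc v)
    (hn : 2 * Fintype.card F + 3 ≤ Fintype.card ι) : IsMaximalThreeArc v where
  toIsThreeArc := hv
  card_eq x i hx hi := by
    have := hv.card_le_card_pointsOn_add hx hi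
    have := hv.card_le x hx
    omega

/-- The nonzero vectors representing a point of the family `v`. -/
def pointCone (v : ι → Fin 3 → F) : Set (Fin 3 → F) :=
  {w | ∃ i, ∃ c : F, c ≠ 0 ∧ w = c • v i}

namespace IsMaximalThreeArc

variable {v : ι → Fin 3 → F}

/-- Group the points by the value b of the ratio. The points with ratio b lie on the line x - b y
through the `i`-th point, which has exactly two others, so the product is that of all b². -/
theorem prod_ratio_eq_one [Fintype F] (hv : IsMaximalThreeArc v) {x y : Fin 3 → F}
    (hxy : x ⨯₃ y ≠ 0) {i : ι} (hix : i ∈ pointsOn v x) (hiy : i ∈ pointsOn v y) :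
    ∏ m ∈ Finset.univ.filter (fun m => x ⬝ᵥ v m ≠ 0 ∧ y ⬝ᵥ v m ≠ 0),
      (x ⬝ᵥ v m) / (y ⬝ᵥ v m) = 1 := by
  classical
  rw [← prod_sq_erase_zero (F := F), ← Finset.prod_fiberwise_of_maps_to
    (t := Finset.univ.erase (0 : F)) (g := fun m => (x ⬝ᵥ v m) / (y ⬝ᵥ v m))]
  · refine Finset.prod_congr rfl fun b hb => ?_
    have hb0 : b ≠ 0 := Finset.ne_of_mem_erase hb
    rw [Finset.prod_congr rfl (g := fun _ => b) (fun m hm => (Finset.mem_filter.mp hm).2),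
      Finset.prod_const]
    congr 1
    have hne : x + (-b) • y ≠ 0 := add_smul_ne_zero_of_cross_ne_zero hxy _
    have hi : i ∈ pointsOn v (x + (-b) • y) := by
      rw [mem_pointsOn] at *
      rw [add_dotProduct, smul_dotProduct, hix, hiy]; simp
    have h3 := hv.card_eq _ i hne hi
    have he : (Finset.univ.filter fun m => x ⬝ᵥ v m ≠ 0 ∧ y ⬝ᵥ v m ≠ 0).filter
        (fun m => (x ⬝ᵥ v m) / (y ⬝ᵥ v m) = b) = (pointsOn v (x + (-b) • y)).erase i := by
      ext m
      simp only [Finset.mem_filter, Finset.mem_univ, true_and, Finset.mem_erase, mem_pointsOn,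
        add_dotProduct, smul_dotProduct, smul_eq_mul]
      constructor
      · rintro ⟨⟨h1, h2⟩, h4⟩
        refine ⟨fun h => h1 (h ▸ mem_pointsOn.mp hix), ?_⟩
        rw [div_eq_iff h2] at h4
        rw [h4]; ring
      · rintro ⟨h1, h2⟩
        have h4 : y ⬝ᵥ v m ≠ 0 := by
          intro hy0
          rw [hy0] at h2
          exact h1 (hv.eq_of_mem_of_mem hxy hix hiy (mem_pointsOn.mpr (by simpa using h2))
            (mem_pointsOn.mpr hy0))
        have h5 : x ⬝ᵥ v m = b * (y ⬝ᵥ v m) := by linear_combination h2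
        refine ⟨⟨?_, h4⟩, ?_⟩
        · rw [h5]; exact mul_ne_zero hb0 h4
        · rw [h5, mul_div_cancel_right₀ _ h4]
    rw [he, Finset.card_erase_of_mem hi, h3]
  · intro m hm
    rw [Finset.mem_filter] at hm
    exact Finset.mem_erase.mpr ⟨div_ne_zero hm.2.1 hm.2.2, Finset.mem_univ _⟩

/-- The contribution of one side of a triangle in the proof of `ceva`. -/
theorem prod_ratio_eq [Fintype F] (hv : IsMaximalThreeArc v) {p₁ p₂ p₃ : Fin 3 → F}
    (h₁ : p₁ ∈ pointCone v) (h₂ : p₂ ∈ pointCone v) (h₃ : p₃ ∈ pointCone v)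
    (hdet : p₁ ⬝ᵥ p₂ ⨯₃ p₃ ≠ 0) {c : F} (hc : c ≠ 0) (h : p₁ + c • p₂ ∈ pointCone v) :
    ∏ m ∈ Finset.univ.filter (fun m => (p₂ ⨯₃ p₃) ⬝ᵥ v m ≠ 0 ∧ (p₃ ⨯₃ p₁) ⬝ᵥ v m ≠ 0 ∧
      (p₁ ⨯₃ p₂) ⬝ᵥ v m ≠ 0), ((p₂ ⨯₃ p₃) ⬝ᵥ v m) / ((p₃ ⨯₃ p₁) ⬝ᵥ v m) = c := by
  classical
  have d1 : (p₂ ⨯₃ p₃) ⬝ᵥ p₁ = p₁ ⬝ᵥ p₂ ⨯₃ p₃ := dotProduct_comm _ _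
  have d2 : (p₃ ⨯₃ p₁) ⬝ᵥ p₂ = p₁ ⬝ᵥ p₂ ⨯₃ p₃ := by
    rw [dotProduct_comm, ← triple_product_permutation]
  have z12 : (p₂ ⨯₃ p₃) ⬝ᵥ p₂ = 0 := by rw [dotProduct_comm, dot_self_cross]
  have z13 : (p₂ ⨯₃ p₃) ⬝ᵥ p₃ = 0 := by rw [dotProduct_comm, dot_cross_self]
  have z23 : (p₃ ⨯₃ p₁) ⬝ᵥ p₃ = 0 := by rw [dotProduct_comm, dot_self_cross]
  have z21 : (p₃ ⨯₃ p₁) ⬝ᵥ p₁ = 0 := by rw [dotProduct_comm, dot_cross_self]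
  have z31 : (p₁ ⨯₃ p₂) ⬝ᵥ p₁ = 0 := by rw [dotProduct_comm, dot_self_cross]
  have z32 : (p₁ ⨯₃ p₂) ⬝ᵥ p₂ = 0 := by rw [dotProduct_comm, dot_cross_self]
  have n3 : p₁ ⨯₃ p₂ ≠ 0 := by
    intro h0
    rw [triple_product_permutation, triple_product_permutation, h0] at hdet
    simp at hdet
  obtain ⟨i, c₁, hc₁, e₁⟩ := h₁
  obtain ⟨j, c₂, hc₂, e₂⟩ := h₂
  obtain ⟨l, c₃, hc₃, e₃⟩ := h₃
  obtain ⟨k, e, he, ek⟩ := h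
  set D := p₁ ⬝ᵥ p₂ ⨯₃ p₃
  set x := p₂ ⨯₃ p₃
  set y := p₃ ⨯₃ p₁
  set z := p₁ ⨯₃ p₂
  have hxy : x ⨯₃ y ≠ 0 := by
    intro h0
    have hy : y ≠ 0 := by
      rintro h1
      rw [h1] at d2
      exact hdet (by rw [← d2]; simp)
    exact hdet (d1 ▸ dot_eq_zero_of_cross_eq_zero hy (cross_comm_eq_zero.mp h0) z21)
  have hz : ∀ (u w : Fin 3 → F) (m : ι) (a : F), a ≠ 0 → w = a • v m →
      (u ⬝ᵥ v m = 0 ↔ u ⬝ᵥ w = 0) := by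
    rintro u w m a ha rfl
    simp [ha]
  have xk : x ⬝ᵥ (p₁ + c • p₂) = D := by
    rw [dotProduct_add, dotProduct_smul, z12, d1]; simp
  have yk : y ⬝ᵥ (p₁ + c • p₂) = c * D := by
    rw [dotProduct_add, dotProduct_smul, z21, d2]; simp
  have zk : z ⬝ᵥ (p₁ + c • p₂) = 0 := by
    rw [dotProduct_add, dotProduct_smul, z31, z32]; simp
  have xi : x ⬝ᵥ v i ≠ 0 := by rw [Ne, hz x p₁ i c₁ hc₁ e₁, d1]; exact hdet
  have yi : y ⬝ᵥ v i = 0 := by rw [hz y p₁ i c₁ hc₁ e₁, z21]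
  have zi : z ⬝ᵥ v i = 0 := by rw [hz z p₁ i c₁ hc₁ e₁, z31]
  have xj : x ⬝ᵥ v j = 0 := by rw [hz x p₂ j c₂ hc₂ e₂, z12]
  have zj : z ⬝ᵥ v j = 0 := by rw [hz z p₂ j c₂ hc₂ e₂, z32]
  have xk0 : x ⬝ᵥ v k ≠ 0 := by rw [Ne, hz x _ k e he ek, xk]; exact hdet
  have yk0 : y ⬝ᵥ v k ≠ 0 := by rw [Ne, hz y _ k e he ek, yk]; exact mul_ne_zero hc hdet
  have zk0 : z ⬝ᵥ v k = 0 := by rw [hz z _ k e he ek, zk]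
  have hij : i ≠ j := fun h => xi (h ▸ xj)
  have hik : i ≠ k := fun h => yk0 (h ▸ yi)
  have hjk : j ≠ k := fun h => xk0 (h ▸ xj)
  have hset : ({i, j, k} : Finset ι) = pointsOn v z := by
    refine Finset.eq_of_subset_of_card_le ?_ ?_
    · intro m hm
      simp only [Finset.mem_insert, Finset.mem_singleton] at hm
      rw [mem_pointsOn]
      rcases hm with rfl | rfl | rfl <;> assumption
    · rw [hv.card_eq z i n3 (mem_pointsOn.mpr zi), Finset.card_eq_three.mpr
        ⟨i, j, k, hij, hik, hjk, rfl⟩]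
  have hP := hv.prod_ratio_eq_one hxy (i := l)
    (mem_pointsOn.mpr (by rw [hz x p₃ l c₃ hc₃ e₃, z13]))
    (mem_pointsOn.mpr (by rw [hz y p₃ l c₃ hc₃ e₃, z23]))
  -- The only point of side `z` off both other sides is its third point `k`, where the ratio is c⁻¹.
  -- Removing it from a product equal to 1 leaves c.
  have hS : Finset.univ.filter (fun m => x ⬝ᵥ v m ≠ 0 ∧ y ⬝ᵥ v m ≠ 0) =
      insert k (Finset.univ.filter (fun m => x ⬝ᵥ v m ≠ 0 ∧ y ⬝ᵥ v m ≠ 0 ∧ z ⬝ᵥ v m ≠ 0)) := by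
    ext m
    simp only [Finset.mem_filter, Finset.mem_univ, true_and, Finset.mem_insert]
    constructor
    · rintro ⟨hx, hy⟩
      by_cases hzm : z ⬝ᵥ v m = 0
      · rw [← mem_pointsOn, ← hset] at hzm
        simp only [Finset.mem_insert, Finset.mem_singleton] at hzm
        rcases hzm with rfl | rfl | rfl
        · exact absurd yi hy
        · exact absurd xj hx
        · exact Or.inl rfl
      · exact Or.inr ⟨hx, hy, hzm⟩
    · rintro (rfl | ⟨hx, hy, -⟩)
      · exact ⟨xk0, yk0⟩
      · exact ⟨hx, hy⟩
  rw [hS, Finset.prod_insert (by simp [zk0])] at hP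
  have hr : (x ⬝ᵥ v k) / (y ⬝ᵥ v k) = c⁻¹ := by
    rw [ek, dotProduct_smul, smul_eq_mul] at xk yk
    rw [div_eq_iff yk0, eq_inv_mul_iff_mul_eq₀ hc]
    refine mul_left_cancel₀ he ?_
    rw [yk, ← xk]; ring
  rw [hr, inv_mul_eq_iff_eq_mul₀ hc, mul_one] at hP
  exact hP

/-- Ceva's condition for a triangle in a maximal arc of degree three. -/
theorem ceva [Fintype F] (hv : IsMaximalThreeArc v) {p₁ p₂ p₃ : Fin 3 → F}
    (h₁ : p₁ ∈ pointCone v) (h₂ : p₂ ∈ pointCone v) (h₃ : p₃ ∈ pointCone v)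
    (hdet : p₁ ⬝ᵥ p₂ ⨯₃ p₃ ≠ 0) {a b c : F} (ha : a ≠ 0) (hb : b ≠ 0) (hc : c ≠ 0)
    (h₁₂ : p₁ + c • p₂ ∈ pointCone v) (h₂₃ : p₂ + a • p₃ ∈ pointCone v)
    (h₃₁ : p₃ + b • p₁ ∈ pointCone v) : a * b * c = 1 := by
  have hdet' := hdet
  rw [triple_product_permutation] at hdet'
  have hdet'' := hdet'
  rw [triple_product_permutation] at hdet''
  have e1 := hv.prod_ratio_eq h₁ h₂ h₃ hdet hc h₁₂
  have e2 := hv.prod_ratio_eq h₂ h₃ h₁ hdet' ha h₂₃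
  have e3 := hv.prod_ratio_eq h₃ h₁ h₂ hdet'' hb h₃₁
  rw [Finset.filter_congr (q := fun m => (p₂ ⨯₃ p₃) ⬝ᵥ v m ≠ 0 ∧ (p₃ ⨯₃ p₁) ⬝ᵥ v m ≠ 0 ∧
      (p₁ ⨯₃ p₂) ⬝ᵥ v m ≠ 0) (fun m _ => by tauto)] at e2 e3
  -- At each point the three ratios are x/y, y/z and z/x up to order, so the combined product
  -- telescopes.
  rw [← e1, ← e2, ← e3, ← Finset.prod_mul_distrib, ← Finset.prod_mul_distrib]
  refine Finset.prod_eq_one fun m hm => ?_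
  obtain ⟨-, h1, h2, h3⟩ := Finset.mem_filter.mp hm
  field_simp

end IsMaximalThreeArc
end MaximalArcs

/-! ### Ceva cones and directions in characteristic three. -/

section CevaCones

variable {F : Type*} [Field F]

/-- A cone over a set of points of a projective plane in which every line through two of the
points has exactly one further point, and every triangle satisfies Ceva's condition. -/
structure IsCevaCone (K : Set (Fin 3 → F)) : Prop where
  ne_zero : ∀ w ∈ K, w ≠ 0
  smul_mem : ∀ w ∈ K, ∀ c : F, c ≠ 0 → c • w ∈ K
  exists_third : ∀ p ∈ K, ∀ r ∈ K, p ⨯₃ r ≠ 0 → ∃ c : F, c ≠ 0 ∧ p + c • r ∈ K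
  third_unique : ∀ p ∈ K, ∀ r ∈ K, p ⨯₃ r ≠ 0 → ∀ c c' : F, c ≠ 0 → c' ≠ 0 →
    p + c • r ∈ K → p + c' • r ∈ K → c = c'
  ceva : ∀ p₁ ∈ K, ∀ p₂ ∈ K, ∀ p₃ ∈ K, p₁ ⬝ᵥ p₂ ⨯₃ p₃ ≠ 0 → p₁ + p₂ ∈ K → p₂ + p₃ ∈ K →
    p₁ + p₃ ∈ K

/-- The third point on a secant supplies the unique scalar. When two of the ratios in `ceva` are 1,
so is the third, which gives the normalized condition. -/
theorem IsMaximalThreeArc.isCevaCone [Fintype F] [DecidableEq F] {ι : Type*} [Fintype ι]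
    {v : ι → Fin 3 → F} (hv : IsMaximalThreeArc v) : IsCevaCone (pointCone v) := by
  classical
  have hne : ∀ w ∈ pointCone v, w ≠ 0 := by
    rintro w ⟨i, c, hc, rfl⟩
    exact smul_ne_zero hc (hv.ne_zero i)
  have hsmul : ∀ w ∈ pointCone v, ∀ c : F, c ≠ 0 → c • w ∈ pointCone v := by
    rintro w ⟨i, c, hc, rfl⟩ e he
    exact ⟨i, e * c, mul_ne_zero he hc, smul_smul _ _ _⟩
  have hex : ∀ p ∈ pointCone v, ∀ r ∈ pointCone v, p ⨯₃ r ≠ 0 → ∃ c : F, c ≠ 0 ∧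
      p + c • r ∈ pointCone v ∧ ∀ c' : F, c' ≠ 0 → p + c' • r ∈ pointCone v → c = c' := by
    rintro p ⟨i, c₁, hc₁, rfl⟩ r ⟨j, c₂, hc₂, rfl⟩ hx
    have hi : i ∈ pointsOn v ((c₁ • v i) ⨯₃ (c₂ • v j)) := by
      rw [mem_pointsOn, dotProduct_comm]; simp
    have hj : j ∈ pointsOn v ((c₁ • v i) ⨯₃ (c₂ • v j)) := by
      rw [mem_pointsOn, dotProduct_comm]; simp
    have hij : i ≠ j := by
      rintro rfl
      simp at hx
    have h3 := hv.card_eq _ i hx hi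
    have h1 : (((pointsOn v ((c₁ • v i) ⨯₃ (c₂ • v j))).erase i).erase j).card = 1 := by
      rw [Finset.card_erase_of_mem (Finset.mem_erase.mpr ⟨hij.symm, hj⟩),
        Finset.card_erase_of_mem hi, h3]
    obtain ⟨k, hk⟩ := Finset.card_eq_one.mp h1
    have hmem : ∀ m, m ∈ pointsOn v ((c₁ • v i) ⨯₃ (c₂ • v j)) → m ≠ i → m ≠ j → m = k := by
      intro m hm hmi hmj
      rw [← Finset.mem_singleton, ← hk]
      exact Finset.mem_erase.mpr ⟨hmj, Finset.mem_erase.mpr ⟨hmi, hm⟩⟩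
    have huniq : ∀ c c' : F, c ≠ 0 → c' ≠ 0 → c₁ • v i + c • c₂ • v j ∈ pointCone v →
        c₁ • v i + c' • c₂ • v j ∈ pointCone v → c = c' := by
      have key : ∀ c : F, c ≠ 0 → c₁ • v i + c • c₂ • v j ∈ pointCone v →
          ∃ e : F, c₁ • v i + c • c₂ • v j = e • v k := by
        rintro c hc ⟨m, e, he, hm⟩
        have hmk : m = k := by
          refine hmem m ?_ ?_ ?_
          · have h0 : ((c₁ • v i) ⨯₃ (c₂ • v j)) ⬝ᵥ (c₁ • v i + c • c₂ • v j) = 0 := by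
              rw [dotProduct_comm]; simp
            rw [hm, dotProduct_smul, smul_eq_mul] at h0
            exact mem_pointsOn.mpr ((mul_eq_zero.mp h0).resolve_left he)
          · rintro rfl
            have h0 := congrArg (fun u => v m ⨯₃ u) hm
            simp only [map_add, map_smul, cross_self, smul_zero, zero_add] at h0
            exact smul_ne_zero hc (smul_ne_zero hc₂ (hv.cross_ne_zero _ _ hij)) h0
          · rintro rfl
            have h0 := congrArg (fun u => v m ⨯₃ u) hm
            simp only [map_add, map_smul, cross_self, smul_zero, add_zero] at h0
            exact smul_ne_zero hc₁ (hv.cross_ne_zero _ _ hij.symm) h0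
        exact ⟨e, hmk ▸ hm⟩
      intro c c' hc hc' h h'
      obtain ⟨e, he⟩ := key c hc h
      obtain ⟨e', he'⟩ := key c' hc' h'
      have h0 : (c₁ • v i + c • c₂ • v j) ⨯₃ (c₁ • v i + c' • c₂ • v j) = 0 := by
        rw [he, he']; simp
      have h5 : (c₁ • v i + c • c₂ • v j) ⨯₃ (c₁ • v i + c' • c₂ • v j) =
          (c' - c) • ((c₁ • v i) ⨯₃ (c₂ • v j)) := by
        funext a
        fin_cases a <;> simp [cross_apply] <;> ring
      rw [h5, smul_eq_zero, or_iff_left hx, sub_eq_zero] at h0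
      exact h0.symm
    have hkm : k ∈ ((pointsOn v ((c₁ • v i) ⨯₃ (c₂ • v j))).erase i).erase j := by
      rw [hk]; exact Finset.mem_singleton_self k
    simp only [Finset.mem_erase] at hkm
    obtain ⟨hkj, hki, hkx⟩ := hkm
    rw [mem_pointsOn, dotProduct_comm] at hkx
    obtain ⟨a, b, hab⟩ := exists_smul_add_smul_of_dot_cross_eq_zero hx hkx
    have ha : a ≠ 0 := by
      rintro rfl
      refine hv.cross_ne_zero j k hkj.symm ?_
      rw [hab]; simp
    have hb : b ≠ 0 := by
      rintro rfl
      refine hv.cross_ne_zero i k hki.symm ?_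
      rw [hab]; simp
    have hmemk : c₁ • v i + (a⁻¹ * b) • c₂ • v j ∈ pointCone v := by
      refine ⟨k, a⁻¹, inv_ne_zero ha, ?_⟩
      rw [hab, smul_add, smul_smul a⁻¹ a, inv_mul_cancel₀ ha, one_smul, smul_smul a⁻¹ b]
    have hne' : a⁻¹ * b ≠ 0 := mul_ne_zero (inv_ne_zero ha) hb
    exact ⟨a⁻¹ * b, hne', hmemk, fun c' hc' h' => huniq _ _ hne' hc' hmemk h'⟩
  refine ⟨hne, hsmul, ?_, ?_, ?_⟩
  · intro p hp r hr hx
    obtain ⟨c, hc, hm, -⟩ := hex p hp r hr hx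
    exact ⟨c, hc, hm⟩
  · intro p hp r hr hx c c' hc hc' h h'
    obtain ⟨e, -, -, hu⟩ := hex p hp r hr hx
    rw [← hu c hc h, ← hu c' hc' h']
  · intro p₁ h₁ p₂ h₂ p₃ h₃ hdet h₁₂ h₂₃
    have hx : p₃ ⨯₃ p₁ ≠ 0 := by
      intro h0
      rw [triple_product_permutation, h0] at hdet
      simp at hdet
    obtain ⟨b, hb, hm, -⟩ := hex p₃ h₃ p₁ h₁ hx
    have := hv.ceva h₁ h₂ h₃ hdet one_ne_zero hb one_ne_zero (by simpa using h₁₂)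
      (by simpa using h₂₃) hm
    rw [one_mul, mul_one] at this
    rw [this, one_smul, add_comm] at hm
    exact hm

namespace IsCevaCone

variable {K : Set (Fin 3 → F)}

theorem neg_mem (hK : IsCevaCone K) {w : Fin 3 → F} (hw : w ∈ K) : -w ∈ K := by
  simpa using hK.smul_mem w hw (-1) (by simp)

/-- In characteristic three a triangle generates an affine plane of order three. -/
theorem add_smul_add_smul_mem (hK : IsCevaCone K) (h3 : (3 : F) = 0) {p₁ p₂ p₃ : Fin 3 → F}
    (h₁ : p₁ ∈ K) (h₂ : p₂ ∈ K) (h₃ : p₃ ∈ K) (hdet : p₁ ⬝ᵥ p₂ ⨯₃ p₃ ≠ 0)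
    (h₁₂ : p₁ + p₂ ∈ K) (h₁₃ : p₁ + p₃ ∈ K) {i j : F} (hi : i = 0 ∨ i = 1 ∨ i = -1)
    (hj : j = 0 ∨ j = 1 ∨ j = -1) : p₁ + i • (p₂ - p₁) + j • (p₃ - p₁) ∈ K := by
  have h₂₁ : p₂ + p₁ ∈ K := by rwa [add_comm]
  have h₃₁ : p₃ + p₁ ∈ K := by rwa [add_comm]
  have d₂₁₃ : p₂ ⬝ᵥ p₁ ⨯₃ p₃ ≠ 0 := by
    intro h0
    apply hdet
    simp only [cross_apply, dotProduct, Fin.sum_univ_three, Matrix.cons_val] at h0 ⊢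
    linear_combination -h0
  have h₂₃ : p₂ + p₃ ∈ K := hK.ceva _ h₂ _ h₁ _ h₃ d₂₁₃ h₂₁ h₁₃
  -- Up to sign the nine points are the vertices, their pairwise sums, and `q1`, `q2`, `q3`. The
  -- last three come from Ceva with one vertex replaced by a negated sum.
  have q1 : p₁ + -(p₂ + p₃) ∈ K := by
    refine hK.ceva _ h₁ _ h₂ _ (hK.neg_mem h₂₃) ?_ h₁₂ ?_
    · intro h0
      apply hdet
      simp only [cross_apply, dotProduct, Fin.sum_univ_three, Matrix.cons_val, Pi.neg_apply,
        Pi.add_apply] at h0 ⊢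
      linear_combination -h0
    · convert hK.neg_mem h₃ using 1; abel
  have q2 : p₂ + -(p₁ + p₃) ∈ K := by
    refine hK.ceva _ h₂ _ h₁ _ (hK.neg_mem h₁₃) ?_ h₂₁ ?_
    · intro h0
      apply hdet
      simp only [cross_apply, dotProduct, Fin.sum_univ_three, Matrix.cons_val, Pi.neg_apply,
        Pi.add_apply] at h0 ⊢
      linear_combination h0
    · convert hK.neg_mem h₃ using 1; abel
  have q3 : p₃ + -(p₁ + p₂) ∈ K := by
    refine hK.ceva _ h₃ _ h₁ _ (hK.neg_mem h₁₂) ?_ h₃₁ ?_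
    · intro h0
      apply hdet
      simp only [cross_apply, dotProduct, Fin.sum_univ_three, Matrix.cons_val, Pi.neg_apply,
        Pi.add_apply] at h0 ⊢
      linear_combination -h0
    · convert hK.neg_mem h₂ using 1; abel
  rcases hi with rfl | rfl | rfl <;> rcases hj with rfl | rfl | rfl
  · convert h₁ using 1; module
  · convert h₃ using 1; module
  · convert hK.neg_mem h₁₃ using 1
    funext k; simp; linear_combination (p₁ k) * h3
  · convert h₂ using 1; module
  · convert hK.neg_mem q1 using 1; module
  · convert hK.neg_mem q3 using 1; module
  · convert hK.neg_mem h₁₂ using 1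
    funext k; simp; linear_combination (p₁ k) * h3
  · convert hK.neg_mem q2 using 1; module
  · convert hK.neg_mem h₂₃ using 1
    funext k; simp; linear_combination (p₁ k) * h3

/-- Every line through the point `a` that meets the cone has the form `w, w + α a, w - α a`. -/
def IsDirection (K : Set (Fin 3 → F)) (a : Fin 3 → F) : Prop :=
  ∀ w ∈ K, w ⨯₃ a ≠ 0 ∧ ∃ α : F, α ≠ 0 ∧ w + α • a ∈ K ∧ w - α • a ∈ K

theorem two_ne_zero_of_three_eq_zero (h3 : (3 : F) = 0) : (2 : F) ≠ 0 := fun h2 =>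
  one_ne_zero (α := F) (by linear_combination h3 - h2)

/-- A point `w` off the line p₁p₂ completes a triangle. After rescaling `w`, the affine plane of
order three it generates contains the translates of `w` by ±(p₂ - p₁). On the line itself, only
multiples of p₁, p₂ and p₁ + p₂ need checking. -/
theorem isDirection (hK : IsCevaCone K) (h3 : (3 : F) = 0) {p₁ p₂ : Fin 3 → F}
    (h₁ : p₁ ∈ K) (h₂ : p₂ ∈ K) (hx : p₁ ⨯₃ p₂ ≠ 0) (h₁₂ : p₁ + p₂ ∈ K) :
    IsDirection K (p₂ - p₁) := by
  intro w hw
  constructor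
  · intro h0
    obtain ⟨c, hc⟩ := exists_smul_of_cross_eq_zero (hK.ne_zero w hw) h0
    by_cases hc0 : c = 0
    · rw [hc0, zero_smul, sub_eq_zero] at hc
      rw [hc] at hx
      simp at hx
    have h4 : p₁ + (-1 : F) • p₂ ∈ K := by
      have := hK.neg_mem (hK.smul_mem w hw c hc0)
      rw [← hc] at this
      convert this using 1; module
    have h5 := hK.third_unique _ h₁ _ h₂ hx 1 (-1) one_ne_zero (by simp) (by simpa using h₁₂) h4
    exact two_ne_zero_of_three_eq_zero h3 (by linear_combination h5)
  by_cases hdet : w ⬝ᵥ p₁ ⨯₃ p₂ = 0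
  · obtain ⟨x, y, rfl⟩ := exists_smul_add_smul_of_dot_cross_eq_zero hx hdet
    by_cases hx0 : x = 0
    · subst hx0
      have hy0 : y ≠ 0 := by
        rintro rfl
        exact hK.ne_zero _ hw (by simp)
      refine ⟨y, hy0, ?_, ?_⟩
      · convert hK.smul_mem _ (hK.neg_mem h₁₂) y hy0 using 1
        funext k; simp; linear_combination (y * p₂ k) * h3
      · convert hK.smul_mem _ h₁ y hy0 using 1; module
    · by_cases hy0 : y = 0
      · subst hy0
        refine ⟨x, hx0, ?_, ?_⟩
        · convert hK.smul_mem _ h₂ x hx0 using 1; module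
        · convert hK.smul_mem _ (hK.neg_mem h₁₂) x hx0 using 1
          funext k; simp; linear_combination (x * p₁ k) * h3
      · have h6 : p₁ + (x⁻¹ * y) • p₂ ∈ K := by
          convert hK.smul_mem _ hw x⁻¹ (inv_ne_zero hx0) using 1
          rw [smul_add, smul_smul, smul_smul, inv_mul_cancel₀ hx0, one_smul]
        have h5 := hK.third_unique _ h₁ _ h₂ hx 1 (x⁻¹ * y) one_ne_zero
          (mul_ne_zero (inv_ne_zero hx0) hy0) (by simpa using h₁₂) h6
        rw [eq_inv_mul_iff_mul_eq₀ hx0, mul_one] at h5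
        subst h5
        refine ⟨x, hx0, ?_, ?_⟩
        · convert hK.smul_mem _ (hK.neg_mem h₂) x hx0 using 1
          funext k; simp; linear_combination (x * p₂ k) * h3
        · convert hK.smul_mem _ (hK.neg_mem h₁) x hx0 using 1
          funext k; simp; linear_combination (x * p₁ k) * h3
  · have hdet' : p₁ ⬝ᵥ p₂ ⨯₃ w ≠ 0 := by
      rw [← triple_product_permutation]; exact hdet
    have hxw : p₁ ⨯₃ w ≠ 0 := by
      intro h0
      rw [triple_product_permutation, ← cross_anticomm, h0] at hdet'
      simp at hdet'
    obtain ⟨c, hc, hm⟩ := hK.exists_third _ h₁ _ hw hxw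
    have hcw := hK.smul_mem w hw c hc
    have hd : p₁ ⬝ᵥ p₂ ⨯₃ (c • w) ≠ 0 := by simp [hc, hdet']
    have m1 := hK.add_smul_add_smul_mem h3 h₁ h₂ hcw hd h₁₂ hm (i := 1) (j := 1)
      (by simp) (by simp)
    have m2 := hK.add_smul_add_smul_mem h3 h₁ h₂ hcw hd h₁₂ hm (i := -1) (j := 1)
      (by simp) (by simp)
    refine ⟨c⁻¹, inv_ne_zero hc, ?_, ?_⟩
    · convert hK.smul_mem _ m1 c⁻¹ (inv_ne_zero hc) using 1
      funext k; simp; field_simp; ring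
    · convert hK.smul_mem _ m2 c⁻¹ (inv_ne_zero hc) using 1
      funext k; simp; field_simp; ring

/-- In characteristic three w + (w + α a) = -(w - α a), so `w - α • a` is already the unique third
point on the line through `w` and `w + α • a`. -/
theorem eq_of_add_smul_mem (hK : IsCevaCone K) (h3 : (3 : F) = 0) {a w : Fin 3 → F}
    (hw : w ∈ K) (hx : w ⨯₃ a ≠ 0) {α x : F} (hα : α ≠ 0) (hp : w + α • a ∈ K)
    (hm : w - α • a ∈ K) (h : w + x • a ∈ K) : x = 0 ∨ x = α ∨ x = -α := by
  by_cases hx0 : x = 0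
  · exact Or.inl hx0
  by_cases hxα : x = α
  · exact Or.inr (Or.inl hxα)
  have hd : α - x ≠ 0 := sub_ne_zero.mpr (Ne.symm hxα)
  have hx2 : w ⨯₃ (w + α • a) ≠ 0 := by
    simp [hα, hx]
  have m1 : w + (1 : F) • (w + α • a) ∈ K := by
    convert hK.neg_mem hm using 1
    funext k; simp; linear_combination (w k) * h3
  have m2 : w + (x / (α - x)) • (w + α • a) ∈ K := by
    convert hK.smul_mem _ h (α / (α - x)) (div_ne_zero hα hd) using 1
    funext k; simp; field_simp; ring
  have h5 := hK.third_unique _ hw _ hp hx2 1 _ one_ne_zero (div_ne_zero hx0 hd) m1 m2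
  rw [eq_div_iff hd] at h5
  right; right
  linear_combination h5 + x * h3

/-- The line through two directions misses the cone. -/
theorem triple_ne_zero (hK : IsCevaCone K) (h3 : (3 : F) = 0) {a b w : Fin 3 → F}
    (ha : IsDirection K a) (hb : IsDirection K b) (hab : a ⨯₃ b ≠ 0) (hw : w ∈ K) :
    w ⬝ᵥ a ⨯₃ b ≠ 0 := by
  intro h0
  obtain ⟨x, y, rfl⟩ := exists_smul_add_smul_of_dot_cross_eq_zero hab h0
  have hna : ∀ z : F, z • a ∉ K := fun z hz => (ha _ hz).1 (by simp)
  have hnb : ∀ z : F, z • b ∉ K := fun z hz => (hb _ hz).1 (by simp)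
  have hx : x ≠ 0 := by
    rintro rfl
    exact hnb y (by simpa using hw)
  have hy : y ≠ 0 := by
    rintro rfl
    exact hna x (by simpa using hw)
  obtain ⟨hxa, α, hα, hα1, hα2⟩ := ha _ hw
  obtain ⟨-, β, hβ, hβ1, hβ2⟩ := hb _ hw
  -- A translate of `w` along `b` stays on the line ab, so it is proportional to a translate along
  -- `a`, whose parameter must be ±α. Taking e = β and e = -β then gives 2αy = 0 or 2αβ = 0.
  have key : ∀ e : F, e ≠ 0 → x • a + y • b + e • b ∈ K →
      y + e ≠ 0 ∧ (-(x * e) / (y + e) = α ∨ -(x * e) / (y + e) = -α) := by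
    intro e he hm
    have hye : y + e ≠ 0 := by
      intro h
      refine hna x ?_
      rw [add_assoc, ← add_smul, h, zero_smul, add_zero] at hm
      exact hm
    refine ⟨hye, ?_⟩
    have hm' : x • a + y • b + (-(x * e) / (y + e)) • a ∈ K := by
      convert hK.smul_mem _ hm (y / (y + e)) (div_ne_zero hy hye) using 1
      funext k; simp; field_simp; ring
    exact (hK.eq_of_add_smul_mem h3 hw hxa hα hα1 hα2 hm').resolve_left
      (div_ne_zero (neg_ne_zero.mpr (mul_ne_zero hx he)) hye)
  obtain ⟨n1, k1⟩ := key β hβ hβ1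
  obtain ⟨n2, k2⟩ := key (-β) (neg_ne_zero.mpr hβ) (by rwa [neg_smul, ← sub_eq_add_neg])
  have h2 := two_ne_zero_of_three_eq_zero h3
  rw [div_eq_iff n1, div_eq_iff n1] at k1
  rw [div_eq_iff n2, div_eq_iff n2] at k2
  have p1 : 2 * (α * y) ≠ 0 := mul_ne_zero h2 (mul_ne_zero hα hy)
  have p2 : 2 * (α * β) ≠ 0 := mul_ne_zero h2 (mul_ne_zero hα hβ)
  rcases k1 with k1 | k1 <;> rcases k2 with k2 | k2
  · exact p1 (by linear_combination -k1 - k2)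
  · exact p2 (by linear_combination -k1 - k2)
  · exact p2 (by linear_combination k1 + k2)
  · exact p1 (by linear_combination k1 + k2)

end IsCevaCone
end CevaCones

/-! ### Partition into affine planes of order three, and the bound 2q + 1. -/

section CevaCones

variable {F : Type*} [Field F]

/-- The coset of `{0, α, -α}` through `x`, in characteristic three. -/
def cubicCoset [Fintype F] [DecidableEq F] (x α : F) : Finset F :=
  -- The coset is a level set of an additive polynomial with roots 0, ±α, so it depends on α only
  -- through α².
  Finset.univ.filter fun u => u ^ 3 - α ^ 2 * u = x ^ 3 - α ^ 2 * x

theorem mem_cubicCoset [Fintype F] [DecidableEq F] (h3 : (3 : F) = 0) {x α u : F} :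
    u ∈ cubicCoset x α ↔ u = x ∨ u = x + α ∨ u = x - α := by
  have h : (u ^ 3 - α ^ 2 * u = x ^ 3 - α ^ 2 * x) ↔
      (u - x) * ((u - (x + α)) * (u - (x - α))) = 0 := by
    constructor <;> intro h
    · linear_combination h + (-(u ^ 2) * x + u * x ^ 2) * h3
    · linear_combination h - (-(u ^ 2) * x + u * x ^ 2) * h3
  simp [cubicCoset, h, sub_eq_zero]

theorem card_cubicCoset [Fintype F] [DecidableEq F] (h3 : (3 : F) = 0) {x α : F} (hα : α ≠ 0) :
    (cubicCoset x α).card = 3 := by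
  have h2 := IsCevaCone.two_ne_zero_of_three_eq_zero h3
  refine Finset.card_eq_three.mpr ⟨x, x + α, x - α, by simpa using hα, ?_, ?_, ?_⟩
  · intro h
    exact hα (by linear_combination h)
  · intro h
    exact mul_ne_zero h2 hα (by linear_combination h)
  · ext u
    rw [mem_cubicCoset h3]
    simp

namespace IsCevaCone

variable {K : Set (Fin 3 → F)}

/-- The affine part of a Ceva cone in characteristic three, in coordinates whose axes at infinity
are directions, is partitioned into affine planes of order three. -/
theorem nine_dvd_card [Fintype F] [DecidableEq F] (hK : IsCevaCone K) (h3 : (3 : F) = 0)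
    {p a b : Fin 3 → F} (ha : IsDirection K a) (hb : IsDirection K b) (hab : a ⨯₃ b ≠ 0)
    (A : Finset (F × F)) (hA : ∀ z, z ∈ A ↔ p + z.1 • a + z.2 • b ∈ K) : 9 ∣ A.card := by
  have hα : ∀ z : F × F, ∃ α : F, z ∈ A → α ≠ 0 ∧ (p + z.1 • a + z.2 • b) + α • a ∈ K ∧
      (p + z.1 • a + z.2 • b) - α • a ∈ K := by
    intro z
    by_cases hz : z ∈ A
    · obtain ⟨-, α, h⟩ := ha _ ((hA z).mp hz)
      exact ⟨α, fun _ => h⟩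
    · exact ⟨0, fun h => absurd h hz⟩
  have hβ : ∀ z : F × F, ∃ β : F, z ∈ A → β ≠ 0 ∧ (p + z.1 • a + z.2 • b) + β • b ∈ K ∧
      (p + z.1 • a + z.2 • b) - β • b ∈ K := by
    intro z
    by_cases hz : z ∈ A
    · obtain ⟨-, α, h⟩ := hb _ ((hA z).mp hz)
      exact ⟨α, fun _ => h⟩
    · exact ⟨0, fun h => absurd h hz⟩
  choose α hα using hα
  choose β hβ using hβ
  have hclosed : ∀ z ∈ A, ∀ i j : F, (i = 0 ∨ i = 1 ∨ i = -1) → (j = 0 ∨ j = 1 ∨ j = -1) →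
      p + (z.1 + i * α z) • a + (z.2 + j * β z) • b ∈ K := by
    intro z hz i j hi hj
    obtain ⟨hα0, hα1, hα2⟩ := hα z hz
    obtain ⟨hβ0, hβ1, hβ2⟩ := hβ z hz
    have hw := (hA z).mp hz
    have hdet := hK.triple_ne_zero h3 ha hb hab hw
    set w := p + z.1 • a + z.2 • b with hwdef
    have hd : w ⬝ᵥ (w + α z • a) ⨯₃ (w + β z • b) ≠ 0 := by
      have e : w ⬝ᵥ (w + α z • a) ⨯₃ (w + β z • b) = (α z * β z) * (w ⬝ᵥ a ⨯₃ b) := by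
        simp only [cross_apply, dotProduct, Fin.sum_univ_three, Matrix.cons_val, Pi.add_apply,
          Pi.smul_apply, smul_eq_mul]
        ring
      rw [e]
      exact mul_ne_zero (mul_ne_zero hα0 hβ0) hdet
    have m1 : w + (w + α z • a) ∈ K := by
      convert hK.neg_mem hα2 using 1
      funext k; simp; linear_combination (w k) * h3
    have m2 : w + (w + β z • b) ∈ K := by
      convert hK.neg_mem hβ2 using 1
      funext k; simp; linear_combination (w k) * h3
    convert hK.add_smul_add_smul_mem h3 hw hα1 hβ1 hd m1 m2 hi hj using 1
    rw [hwdef]; module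
  have hsgn : ∀ x u e : F, (u = x ∨ u = x + e ∨ u = x - e) →
      ∃ i : F, (i = 0 ∨ i = 1 ∨ i = -1) ∧ u = x + i * e := by
    rintro x u e (rfl | rfl | rfl)
    · exact ⟨0, by simp, by ring⟩
    · exact ⟨1, by simp, by ring⟩
    · exact ⟨-1, by simp, by ring⟩
  let S : F × F → Finset (F × F) := fun z => cubicCoset z.1 (α z) ×ˢ cubicCoset z.2 (β z)
  have hS : ∀ z ∈ A, ∀ u ∈ S z, ∀ i j : F, (i = 0 ∨ i = 1 ∨ i = -1) → (j = 0 ∨ j = 1 ∨ j = -1) →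
      p + (u.1 + i * α z) • a + (u.2 + j * β z) • b ∈ K := by
    intro z hz u hu i j hi hj
    obtain ⟨hu1, hu2⟩ := Finset.mem_product.mp hu
    have e1 : u.1 + i * α z ∈ cubicCoset z.1 (α z) := by
      have : u.1 + i * α z ∈ cubicCoset u.1 (α z) := by
        rw [mem_cubicCoset h3]
        rcases hi with rfl | rfl | rfl
        · left; ring
        · right; left; ring
        · right; right; ring
      simp only [cubicCoset, Finset.mem_filter, Finset.mem_univ, true_and] at this hu1 ⊢
      rw [this, hu1]
    have e2 : u.2 + j * β z ∈ cubicCoset z.2 (β z) := by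
      have : u.2 + j * β z ∈ cubicCoset u.2 (β z) := by
        rw [mem_cubicCoset h3]
        rcases hj with rfl | rfl | rfl
        · left; ring
        · right; left; ring
        · right; right; ring
      simp only [cubicCoset, Finset.mem_filter, Finset.mem_univ, true_and] at this hu2 ⊢
      rw [this, hu2]
    obtain ⟨i', hi', h1⟩ := hsgn _ _ _ ((mem_cubicCoset h3).mp e1)
    obtain ⟨j', hj', h2⟩ := hsgn _ _ _ ((mem_cubicCoset h3).mp e2)
    rw [h1, h2]
    exact hclosed z hz i' j' hi' hj'
  have hsub : ∀ z ∈ A, S z ⊆ A := by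
    intro z hz u hu
    rw [hA]
    simpa using hS z hz u hu 0 0 (by simp) (by simp)
  refine dvd_card_of_forall_mem_class A S ?_ ?_ hsub ?_
  · intro z _
    simp [S, mem_cubicCoset h3]
  · intro z hz
    rw [Finset.card_product, card_cubicCoset h3 (hα z hz).1, card_cubicCoset h3 (hβ z hz).1]
  · intro z hz u hu
    have huA := hsub z hz hu
    have huK := (hA u).mp huA
    have sq : ∀ x y : F, x ≠ 0 → (x = 0 ∨ x = y ∨ x = -y) → x ^ 2 = y ^ 2 := by
      rintro x y hx (h | h | h)
      · exact absurd h hx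
      · rw [h]
      · rw [h, neg_sq]
    -- The step `α z` also leads from `u` to a cone point, so it is ±`α u`. Equal squares make the
    -- two cosets coincide.
    have hα2 : α z ^ 2 = α u ^ 2 := by
      obtain ⟨h0, h1, h2⟩ := hα u huA
      refine sq _ _ (hα z hz).1 (hK.eq_of_add_smul_mem h3 huK (ha _ huK).1 h0 h1 h2 ?_)
      convert hS z hz u hu 1 0 (by simp) (by simp) using 1
      module
    have hβ2 : β z ^ 2 = β u ^ 2 := by
      obtain ⟨h0, h1, h2⟩ := hβ u huA
      refine sq _ _ (hβ z hz).1 (hK.eq_of_add_smul_mem h3 huK (hb _ huK).1 h0 h1 h2 ?_)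
      convert hS z hz u hu 0 1 (by simp) (by simp) using 1
      module
    obtain ⟨hu1, hu2⟩ := Finset.mem_product.mp hu
    simp only [cubicCoset, Finset.mem_filter, Finset.mem_univ, true_and] at hu1 hu2
    simp only [S, cubicCoset, ← hα2, ← hβ2, hu1, hu2]

end IsCevaCone

/-- A maximal arc of degree three in characteristic three has a multiple of nine points. -/
theorem IsMaximalThreeArc.nine_dvd_card [Fintype F] [DecidableEq F] (h3 : (3 : F) = 0) {ι : Type*}
    [Fintype ι] {v : ι → Fin 3 → F} (hv : IsMaximalThreeArc v) (hn : 3 < Fintype.card ι) :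
    9 ∣ Fintype.card ι := by
  classical
  have hK := hv.isCevaCone
  have hmem : ∀ i, v i ∈ pointCone v := fun i => ⟨i, 1, one_ne_zero, (one_smul _ _).symm⟩
  have : Nontrivial ι := Fintype.one_lt_card_iff_nontrivial.mp (by omega)
  obtain ⟨i, j, hij⟩ := exists_pair_ne ι
  have hx := hv.cross_ne_zero i j hij
  obtain ⟨l, hl⟩ : ∃ l, v i ⬝ᵥ v j ⨯₃ v l ≠ 0 := by
    by_contra! H
    have h1 := hv.card_le _ hx
    have h2 : pointsOn v (v i ⨯₃ v j) = Finset.univ := by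
      refine Finset.eq_univ_of_forall fun m => ?_
      rw [mem_pointsOn, dotProduct_comm, triple_product_permutation]
      exact H m
    rw [h2, Finset.card_univ] at h1
    omega
  obtain ⟨c, hc, h12⟩ := hK.exists_third _ (hmem i) _ (hmem j) hx
  have hx' : v i ⨯₃ v l ≠ 0 := by
    intro h0
    rw [triple_product_permutation, ← cross_anticomm, h0] at hl
    simp at hl
  obtain ⟨d, hd, h13⟩ := hK.exists_third _ (hmem i) _ (hmem l) hx'
  have ha := hK.isDirection h3 (hmem i) (hK.smul_mem _ (hmem j) c hc) (by simp [hc, hx]) h12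
  have hb := hK.isDirection h3 (hmem i) (hK.smul_mem _ (hmem l) d hd) (by simp [hd, hx']) h13
  set a := c • v j - v i with hadef
  set b := d • v l - v i with hbdef
  have hdet : v i ⬝ᵥ a ⨯₃ b ≠ 0 := by
    have e : v i ⬝ᵥ a ⨯₃ b = (c * d) * (v i ⬝ᵥ v j ⨯₃ v l) := by
      simp only [hadef, hbdef, cross_apply, dotProduct, Fin.sum_univ_three, Matrix.cons_val,
        Pi.sub_apply, Pi.smul_apply, smul_eq_mul]
      ring
    rw [e]
    exact mul_ne_zero (mul_ne_zero hc hd) hl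
  have hab : a ⨯₃ b ≠ 0 := by
    intro h0
    rw [h0] at hdet
    simp at hdet
  -- The line through the two directions misses the arc, so it serves as the line at infinity and
  -- Cramer's rule gives affine coordinates.
  have hcoord : ∀ m, ∃ z : F × F, ∃ e : F, e ≠ 0 ∧ v i + z.1 • a + z.2 • b = e • v m := by
    intro m
    have hm := hK.triple_ne_zero h3 ha hb hab (hmem m)
    refine ⟨((v i ⬝ᵥ v m ⨯₃ b) / (v m ⬝ᵥ a ⨯₃ b), (v i ⬝ᵥ a ⨯₃ v m) / (v m ⬝ᵥ a ⨯₃ b)),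
      (v i ⬝ᵥ a ⨯₃ b) / (v m ⬝ᵥ a ⨯₃ b), div_ne_zero hdet hm, ?_⟩
    refine smul_right_injective _ hm ?_
    simp only [smul_add, smul_smul, mul_div_cancel₀ _ hm]
    funext k
    simp only [cross_apply, dotProduct, Fin.sum_univ_three, Matrix.cons_val, Pi.add_apply,
      Pi.smul_apply, smul_eq_mul]
    fin_cases k <;> simp only [Fin.mk_one, Fin.zero_eta, Fin.reduceFinMk] <;> ring
  choose φ e he hφ using hcoord
  have hcard : (Finset.univ.filter fun z : F × F => v i + z.1 • a + z.2 • b ∈ pointCone v).card =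
      Fintype.card ι := by
    rw [← Finset.card_univ]
    symm
    refine Finset.card_bij (fun m _ => φ m) ?_ ?_ ?_
    · intro m _
      rw [Finset.mem_filter]
      exact ⟨Finset.mem_univ _, m, e m, he m, hφ m⟩
    · intro m _ m' _ h
      by_contra hne
      have h1 : (e m • v m) ⨯₃ (e m' • v m') = 0 := by
        rw [← hφ m, ← hφ m', h, cross_self]
      simp [he m, he m', hv.cross_ne_zero m m' hne] at h1
    · intro z hz
      obtain ⟨-, m, f, hf, hm⟩ := Finset.mem_filter.mp hz
      refine ⟨m, Finset.mem_univ _, ?_⟩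
      have h1 : (e m)⁻¹ • (v i + (φ m).1 • a + (φ m).2 • b) =
          f⁻¹ • (v i + z.1 • a + z.2 • b) := by
        rw [hφ, hm, smul_smul, smul_smul, inv_mul_cancel₀ hf, inv_mul_cancel₀ (he m)]
      have hdot : ∀ (u : F × F), (v i + u.1 • a + u.2 • b) ⬝ᵥ a ⨯₃ b = v i ⬝ᵥ a ⨯₃ b := by
        intro u
        simp [add_dotProduct]
      have h2 := congrArg (fun w => w ⬝ᵥ a ⨯₃ b) h1
      simp only [smul_dotProduct, hdot, smul_eq_mul] at h2
      rw [mul_right_cancel₀ hdet h2] at h1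
      have h3' := smul_right_injective _ (inv_ne_zero hf) h1
      have h4 := congrArg (fun w => b ⨯₃ w ⬝ᵥ v i) h3'
      have h5 := congrArg (fun w => a ⨯₃ w ⬝ᵥ v i) h3'
      have t1 : b ⨯₃ a ⬝ᵥ v i = -(v i ⬝ᵥ a ⨯₃ b) := by
        rw [← cross_anticomm, neg_dotProduct, dotProduct_comm]
      have t2 : a ⨯₃ b ⬝ᵥ v i = v i ⬝ᵥ a ⨯₃ b := dotProduct_comm _ _
      have s1 : b ⨯₃ v i ⬝ᵥ v i = 0 := by rw [dotProduct_comm, dot_cross_self]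
      have s2 : a ⨯₃ v i ⬝ᵥ v i = 0 := by rw [dotProduct_comm, dot_cross_self]
      simp only [map_add, map_smul, add_dotProduct, smul_dotProduct, cross_self, smul_zero,
        t1, t2, s1, s2, smul_eq_mul, add_zero, zero_add] at h4 h5
      exact Prod.ext (mul_right_cancel₀ (neg_ne_zero.mpr hdet) h4) (mul_right_cancel₀ hdet h5)
  rw [← hcard]
  exact hK.nine_dvd_card h3 (p := v i) ha hb hab _ fun z => by simp

theorem IsThreeArc.comp_injective [DecidableEq F] {ι κ : Type*} [Fintype ι] [Fintype κ]
    {v : ι → Fin 3 → F} (hv : IsThreeArc v) {f : κ → ι} (hf : Function.Injective f) :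
    IsThreeArc (v ∘ f) where
  ne_zero i := hv.ne_zero _
  cross_ne_zero i j hij := hv.cross_ne_zero _ _ (hf.ne hij)
  card_le x hx := (Finset.card_le_card_of_injOn f
    (fun m hm => by simpa [mem_pointsOn] using hm) hf.injOn).trans (hv.card_le x hx)

/-- In a projective plane over a field with `q > 3` elements, a set with at most three points on
each line has at most `2 * q + 1` points. -/
theorem IsThreeArc.card_le_two_mul_add_one [Fintype F] [DecidableEq F] {ι : Type*} [Fintype ι]
    {v : ι → Fin 3 → F} (hv : IsThreeArc v) (hq : 3 < Fintype.card F) :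
    Fintype.card ι ≤ 2 * Fintype.card F + 1 := by
  by_contra! hlt
  obtain ⟨f⟩ : Nonempty (Fin (2 * Fintype.card F + 2) ↪ ι) :=
    Function.Embedding.nonempty_of_card_le (by rw [Fintype.card_fin]; omega)
  obtain ⟨h3, w, hw⟩ := (hv.comp_injective f.injective).exists_extension
    (by rw [Fintype.card_fin]) hq
  have hcard : Fintype.card (Option (Fin (2 * Fintype.card F + 2))) = 2 * Fintype.card F + 3 := by
    rw [Fintype.card_option, Fintype.card_fin]
  have hmax := hw.isMaximalThreeArc hcard.ge
  obtain ⟨p, hp⟩ := CharP.exists F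
  obtain ⟨n, hprime, hn⟩ := FiniteField.card F p
  have hp3 : 3 = p := (Nat.prime_dvd_prime_iff_eq Nat.prime_three hprime).mp
    (Nat.prime_three.dvd_of_dvd_pow (hn ▸ h3))
  subst hp3
  -- The order is a power of 3 exceeding 3.
  have h9 : 9 ∣ Fintype.card F := by
    rw [hn] at hq ⊢
    refine pow_dvd_pow 3 (m := 2) ?_
    by_contra! h
    have h1 : (n : ℕ) ≤ 1 := by omega
    exact absurd (Nat.pow_le_pow_right (n := 3) (by norm_num) h1) (by omega)
  have h := hmax.nine_dvd_card (by exact_mod_cast CharP.cast_eq_zero F 3) (by omega)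
  rw [hcard] at h
  omega
end CevaCones

/-! ### Duality, shortening and puncturing of codes. -/

section Codes

variable {F : Type*} [Field F] {n : ℕ}

theorem mem_dualCode {C : Submodule F (Fin n → F)} {y : Fin n → F} :
    y ∈ dualCode C ↔ ∀ x ∈ C, y ⬝ᵥ x = 0 := Iff.rfl

theorem finrank_dualCode (C : Submodule F (Fin n → F)) :
    Module.finrank F C + Module.finrank F (dualCode C) = n := by
  have h : dualCode C = C.dualAnnihilator.comap (dotProductEquiv F (Fin n)).toLinearMap := by
    ext y
    simp [mem_dualCode, Submodule.mem_dualAnnihilator]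
  have h2 := Subspace.finrank_add_finrank_dualAnnihilator_eq C
  rw [Module.finrank_fin_fun] at h2
  rw [h, ((dotProductEquiv F (Fin n)).ofSubmodule' C.dualAnnihilator).finrank_eq, h2]

theorem dualCode_dualCode (C : Submodule F (Fin n → F)) : dualCode (dualCode C) = C := by
  symm
  refine Submodule.eq_of_le_of_finrank_eq (fun x hx y hy => ?_) ?_
  · rw [dotProduct_comm]; exact hy x hx
  · have h1 := finrank_dualCode C
    have h2 := finrank_dualCode (dualCode C)
    omega

/-- The codewords of `C` that vanish on `S`. -/
def shortenedCode (C : Submodule F (Fin n → F)) (S : Finset (Fin n)) :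
    Submodule F (Fin n → F) :=
  C ⊓ LinearMap.ker (LinearMap.funLeft F F (Subtype.val : S → Fin n))

theorem mem_shortenedCode {C : Submodule F (Fin n → F)} {S : Finset (Fin n)} {x : Fin n → F} :
    x ∈ shortenedCode C S ↔ x ∈ C ∧ ∀ i ∈ S, x i = 0 := by
  simp [shortenedCode, funext_iff, LinearMap.funLeft_apply]

theorem finrank_range_add_finrank_shortenedCode (C : Submodule F (Fin n → F))
    (S : Finset (Fin n)) :
    Module.finrank F (C.map (LinearMap.funLeft F F (Subtype.val : S → Fin n))) +
      Module.finrank F (shortenedCode C S) = Module.finrank F C := by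
  have h := LinearMap.finrank_range_add_finrank_ker
    ((LinearMap.funLeft F F (Subtype.val : S → Fin n)).domRestrict C)
  rw [LinearMap.range_domRestrict, LinearMap.ker_domRestrict] at h
  rw [← h, ← Submodule.finrank_map_subtype_eq C (Submodule.comap C.subtype _),
    Submodule.map_comap_subtype, shortenedCode]

theorem finrank_le_finrank_shortenedCode_add (C : Submodule F (Fin n → F)) (S : Finset (Fin n)) :
    Module.finrank F C ≤ Module.finrank F (shortenedCode C S) + S.card := by
  have h := finrank_range_add_finrank_shortenedCode C S
  have h2 := Submodule.finrank_le (C.map (LinearMap.funLeft F F (Subtype.val : S → Fin n)))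
  rw [Module.finrank_fintype_fun_eq_card, Fintype.card_coe] at h2
  omega

/-- Coordinates are independent on `C` as long as the dual code has no word supported on them. -/
theorem finrank_shortenedCode_add [DecidableEq F] (C : Submodule F (Fin n → F))
    (S : Finset (Fin n)) (h : ∀ y ∈ dualCode C, y ≠ 0 → S.card < hammingNorm y) :
    Module.finrank F (shortenedCode C S) + S.card = Module.finrank F C := by
  have hr := finrank_range_add_finrank_shortenedCode C S
  -- If restriction to `S` were not onto, a functional killing its image, extended by zero, would be
  -- a dual word supported in `S`.
  have htop : C.map (LinearMap.funLeft F F (Subtype.val : S → Fin n)) = ⊤ := by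
    by_contra hlt
    obtain ⟨f, hf, hle⟩ := Submodule.exists_le_ker_of_lt_top _ (lt_top_iff_ne_top.mpr hlt)
    obtain ⟨u, rfl⟩ := (dotProductEquiv F S).surjective f
    have hu : u ≠ 0 := by
      rintro rfl
      simp at hf
    let y : Fin n → F := fun i => if hi : i ∈ S then u ⟨i, hi⟩ else 0
    have hyS : ∀ i : S, y i = u i := fun i => by simp [y]
    have hy : y ∈ dualCode C := by
      intro x hx
      have h1 := hle (Submodule.mem_map_of_mem hx)
      rw [LinearMap.mem_ker, dotProductEquiv_apply_apply] at h1
      rw [← h1, dotProduct, dotProduct, ← Finset.sum_subset (Finset.subset_univ S)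
        (fun i _ hi => by simp [y, hi]), ← Finset.sum_coe_sort]
      exact Finset.sum_congr rfl fun i _ => by rw [hyS, LinearMap.funLeft_apply]
    have hy0 : y ≠ 0 := by
      intro h0
      refine hu (funext fun i => ?_)
      rw [← hyS, h0]; rfl
    refine absurd (h y hy hy0) (not_lt.mpr (Finset.card_le_card fun i hi => ?_))
    by_contra hiS
    simp [y, hiS] at hi
  rw [htop, finrank_top, Module.finrank_fintype_fun_eq_card, Fintype.card_coe] at hr
  omega

/-- A subspace of dimension at least two has an element outside any given line. -/
theorem exists_mem_forall_ne_smul {V : Type*} [AddCommGroup V] [Module F V]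
    [FiniteDimensional F V] {W : Submodule F V} (hW : 2 ≤ Module.finrank F W) (h : V) :
    ∃ g ∈ W, ∀ c : F, g ≠ c • h := by
  by_contra! H
  have hle : W ≤ Submodule.span F {h} := fun g hg => by
    obtain ⟨c, rfl⟩ := H g hg
    exact Submodule.smul_mem _ _ (Submodule.mem_span_singleton_self h)
  have h1 := Submodule.finrank_mono hle
  have h2 := finrank_span_le_card (R := F) ({h} : Set V)
  rw [Set.toFinset_singleton, Finset.card_singleton] at h2
  omega

variable [DecidableEq F]

/-- The coordinates at which a word vanishes. -/
def zeroSet (x : Fin n → F) : Finset (Fin n) := Finset.univ.filter fun i => x i = 0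

theorem mem_zeroSet {x : Fin n → F} {i : Fin n} : i ∈ zeroSet x ↔ x i = 0 := by
  simp [zeroSet]

theorem card_zeroSet_add_hammingNorm (x : Fin n → F) : (zeroSet x).card + hammingNorm x = n := by
  have h := Finset.card_filter_add_card_filter_not (s := Finset.univ) (fun i => x i = 0)
  rwa [Finset.card_univ, Fintype.card_fin] at h

theorem IsLinearCode.le_hammingNorm {C : Submodule F (Fin n → F)} {k d : ℕ}
    (hC : IsLinearCode C k d) {x : Fin n → F} (hx : x ∈ C) (h0 : x ≠ 0) : d ≤ hammingNorm x :=
  hC.2.2 ⟨x, hx, 0, C.zero_mem, h0, hammingDist_zero_right x⟩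

theorem IsLinearCode.exists_hammingNorm_eq {C : Submodule F (Fin n → F)} {k d : ℕ}
    (hC : IsLinearCode C k d) : ∃ x ∈ C, x ≠ 0 ∧ hammingNorm x = d := by
  obtain ⟨x, hx, y, hy, hxy, h⟩ := hC.2.1
  exact ⟨-x + y, C.add_mem (C.neg_mem hx) hy, fun h0 => hxy (neg_add_eq_zero.mp h0), by rw [← h, hammingDist_eq_hammingNorm]⟩

theorem isLinearCode_of_hammingNorm {C : Submodule F (Fin n → F)} {k d : ℕ}
    (hk : Module.finrank F C = k) (hle : ∀ x ∈ C, x ≠ 0 → d ≤ hammingNorm x)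
    (hex : ∃ x ∈ C, x ≠ 0 ∧ hammingNorm x ≤ d) : IsLinearCode C k d := by
  refine ⟨hk, ?_, ?_⟩
  · obtain ⟨x, hx, h0, h⟩ := hex
    exact ⟨x, hx, 0, C.zero_mem, h0, by
      rw [hammingDist_zero_right]; exact le_antisymm h (hle x hx h0)⟩
  · rintro w ⟨x, hx, y, hy, hxy, rfl⟩
    rw [hammingDist_eq_hammingNorm]
    exact hle _ (C.add_mem (C.neg_mem hx) hy) fun h0 => hxy (neg_add_eq_zero.mp h0)

/-- The pencil bound for two words vanishing on `S`, when such words also vanish on `T`. -/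
theorem card_add_mul_card_le [Fintype F] {C : Submodule F (Fin n → F)} {N : ℕ}
    (hN : ∀ x ∈ C, x ≠ 0 → (zeroSet x).card ≤ N) {S T : Finset (Fin n)}
    (hS : S.card + 2 ≤ Module.finrank F C)
    (hST : ∀ x ∈ C, (∀ i ∈ S, x i = 0) → ∀ i ∈ T, x i = 0) {h : Fin n → F} (hC : h ∈ C)
    (hhS : ∀ i ∈ S, h i = 0) :
    n + Fintype.card F * T.card ≤ (zeroSet h).card + Fintype.card F * N := by
  have hdim := finrank_le_finrank_shortenedCode_add C S
  obtain ⟨g, hg, hgh⟩ :=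
    exists_mem_forall_ne_smul (W := shortenedCode C S) (by omega) h
  obtain ⟨hgC, hgS⟩ := mem_shortenedCode.mp hg
  have hp := card_add_card_mul_card_common_zeros g h
  have hT : T.card ≤ (Finset.univ.filter fun i => g i = 0 ∧ h i = 0).card := by
    refine Finset.card_le_card fun i hi => ?_
    rw [Finset.mem_filter]
    exact ⟨Finset.mem_univ _, hST g hgC hgS i hi, hST h hC hhS i hi⟩
  have hsum : ∑ c : F, (Finset.univ.filter fun i => g i + c * h i = 0).card ≤ ∑ _c : F, N := by
    refine Finset.sum_le_sum fun c _ => hN (g + c • h) (C.add_mem hgC (C.smul_mem c hC)) ?_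
    intro h0
    exact hgh (-c) (by rw [neg_smul]; exact eq_neg_of_add_eq_zero_left h0)
  rw [Finset.sum_const, Finset.card_univ, smul_eq_mul] at hsum
  rw [Fintype.card_fin] at hp
  have := Nat.mul_le_mul_left (Fintype.card F) hT
  have hz : (Finset.univ.filter fun i => h i = 0).card = (zeroSet h).card := rfl
  omega

/-- Puncturing at the support of a word gives an MDS code when the dual code is almost MDS. -/
theorem card_zeroSet_le_maxMDSLength {C : Submodule F (Fin n → F)} {k : ℕ}
    (hk : Module.finrank F C = k) (hk2 : 2 ≤ k) (hnd : IsNondegenerateCode C)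
    (hdual : ∀ y ∈ dualCode C, y ≠ 0 → k ≤ hammingNorm y) {x : Fin n → F} (hx : x ∈ C)
    (hx0 : x ≠ 0) (hZ : k - 1 ≤ (zeroSet x).card) :
    ((zeroSet x).card : ℕ∞) ≤ maxMDSLength F (k - 1) := by
  -- Any k - 1 coordinates are independent, so only a line of codewords vanishes on them, and `x`
  -- spans it.
  have hspan : ∀ S ⊆ zeroSet x, S.card = k - 1 → ∀ w ∈ C, (∀ i ∈ S, w i = 0) →
      ∃ c : F, c • x = w := by
    intro S hS hcard w hw hwS
    have h1 := finrank_shortenedCode_add C S fun y hy h0 => by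
      have := hdual y hy h0
      omega
    have h2 : Module.finrank F (shortenedCode C S) = 1 := by omega
    have hxS : x ∈ shortenedCode C S :=
      mem_shortenedCode.mpr ⟨hx, fun i hi => mem_zeroSet.mp (hS hi)⟩
    obtain ⟨c, hc⟩ := (finrank_eq_one_iff_of_nonzero' (⟨x, hxS⟩ : shortenedCode C S)
      (fun h => hx0 (congrArg Subtype.val h))).mp h2 ⟨w, mem_shortenedCode.mpr ⟨hw, hwS⟩⟩
    exact ⟨c, congrArg Subtype.val hc⟩
  generalize hN : (zeroSet x).card = N at hZ
  let e : Fin N ↪ Fin n := ((zeroSet x).orderEmbOfFin hN).toEmbedding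
  have he : ∀ j, e j ∈ zeroSet x := fun j => Finset.orderEmbOfFin_mem _ hN j
  have hex : ∀ i ∈ zeroSet x, ∃ j, e j = i := by
    intro i hi
    rw [← Finset.mem_coe, ← Finset.range_orderEmbOfFin (zeroSet x) hN] at hi
    exact hi
  have hvanish : ∀ T : Finset (Fin N), k - 1 ≤ T.card → ∀ w ∈ C, (∀ j ∈ T, w (e j) = 0) →
      ∃ c : F, c • x = w := by
    intro T hT w hw hwT
    obtain ⟨U, hUT, hU⟩ := Finset.exists_subset_card_eq hT
    refine hspan (U.map e) ?_ (by rw [Finset.card_map, hU]) w hw ?_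
    · intro i hi
      obtain ⟨j, -, rfl⟩ := Finset.mem_map.mp hi
      exact he j
    · intro i hi
      obtain ⟨j, hj, rfl⟩ := Finset.mem_map.mp hi
      exact hwT j (hUT hj)
  let D : Submodule F (Fin N → F) := C.map (LinearMap.funLeft F F e)
  have hDk : Module.finrank F D = k - 1 := by
    have h := LinearMap.finrank_range_add_finrank_ker ((LinearMap.funLeft F F e).domRestrict C)
    rw [LinearMap.range_domRestrict] at h
    have hxk : (⟨x, hx⟩ : C) ∈ LinearMap.ker ((LinearMap.funLeft F F e).domRestrict C) := by
      rw [LinearMap.mem_ker]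
      funext j
      have hj : x (e j) = 0 := mem_zeroSet.mp (he j)
      exact hj
    have h1 : Module.finrank F
        (LinearMap.ker ((LinearMap.funLeft F F e).domRestrict C)) = 1 := by
      refine (finrank_eq_one_iff_of_nonzero' ⟨⟨x, hx⟩, hxk⟩ fun h0 => hx0
        (congrArg (fun u : LinearMap.ker ((LinearMap.funLeft F F e).domRestrict C) =>
          ((u : C) : Fin n → F)) h0)).mpr ?_
      rintro ⟨⟨w, hw⟩, hwk⟩
      rw [LinearMap.mem_ker] at hwk
      obtain ⟨c, hc⟩ := hvanish Finset.univ (by rw [Finset.card_univ, Fintype.card_fin]; exact hZ)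
        w hw (fun j _ => congrFun hwk j)
      exact ⟨c, Subtype.ext (Subtype.ext hc)⟩
    rw [h1, hk] at h
    change Module.finrank F D + 1 = k at h
    omega
  have hDmin : ∀ u ∈ D, u ≠ 0 → N - (k - 1) + 1 ≤ hammingNorm u := by
    intro u hu hu0
    obtain ⟨w, hw, rfl⟩ := Submodule.mem_map.mp hu
    have hcard := card_zeroSet_add_hammingNorm (LinearMap.funLeft F F e w)
    by_contra! hlt
    obtain ⟨c, rfl⟩ := hvanish (zeroSet (LinearMap.funLeft F F e w)) (by omega) w hw
      (fun j hj => by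
        have h0 : LinearMap.funLeft F F e w j = 0 := mem_zeroSet.mp hj
        exact h0)
    refine hu0 (funext fun j => ?_)
    have := mem_zeroSet.mp (he j)
    simp [LinearMap.funLeft_apply, this]
  have hDex : ∃ u ∈ D, u ≠ 0 ∧ hammingNorm u ≤ N - (k - 1) + 1 := by
    obtain ⟨S, -, hS⟩ := Finset.exists_subset_card_eq
      (s := (Finset.univ : Finset (Fin N))) (n := k - 2)
      (by rw [Finset.card_univ, Fintype.card_fin]; omega)
    have h1 := finrank_le_finrank_shortenedCode_add D S
    obtain ⟨u, hu, hu0⟩ := Submodule.exists_mem_ne_zero_of_ne_bot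
      (p := shortenedCode D S) (by
        intro h0
        rw [h0, finrank_bot] at h1
        omega)
    obtain ⟨huD, huS⟩ := mem_shortenedCode.mp hu
    have h2 := card_zeroSet_add_hammingNorm u
    have h3 : S.card ≤ (zeroSet u).card :=
      Finset.card_le_card fun i hi => mem_zeroSet.mpr (huS i hi)
    exact ⟨u, huD, hu0, by omega⟩
  refine le_sSup ⟨N, N - (k - 1) + 1, D, ?_, ⟨isLinearCode_of_hammingNorm hDk hDmin hDex, ?_⟩, rfl⟩
  · intro j
    obtain ⟨w, hw, hwj⟩ := hnd (e j)
    exact ⟨LinearMap.funLeft F F e w, Submodule.mem_map_of_mem hw, hwj⟩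
  · unfold singletonDefect
    push_cast [Nat.cast_sub hZ]
    ring

/-- The length bound for near-MDS codes, by shortening to dimension three. -/
theorem length_le_of_nearMDS [Fintype F] {C : Submodule F (Fin n → F)} {k : ℕ}
    (hk : Module.finrank F C = k) (hk3 : 3 ≤ k)
    (hzero : ∀ x ∈ C, x ≠ 0 → (zeroSet x).card ≤ k)
    (hdual : ∀ y ∈ dualCode C, y ≠ 0 → k ≤ hammingNorm y) (hq : 3 < Fintype.card F) :
    n + 2 ≤ 2 * Fintype.card F + k := by
  have hfin : ∀ S : Finset (Fin n), S.card < k →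
      Module.finrank F (shortenedCode C S) + S.card = k := by
    intro S hS
    rw [finrank_shortenedCode_add C S fun y hy h0 => hS.trans_le (hdual y hy h0), hk]
  have hkn : k ≤ n := by
    have := finrank_dualCode C
    omega
  obtain ⟨S, -, hS⟩ := Finset.exists_subset_card_eq
    (s := (Finset.univ : Finset (Fin n))) (n := k - 3)
    (by rw [Finset.card_univ, Fintype.card_fin]; omega)
  have h3 : Module.finrank F (shortenedCode C S) = 3 := by
    have := hfin S (by omega)
    omega
  let b : Module.Basis (Fin 3) F (shortenedCode C S) := Module.finBasisOfFinrankEq F _ h3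
  let word : (Fin 3 → F) → shortenedCode C S := fun x => b.equivFun.symm x
  -- The points of the arc are the columns of a generator matrix of the shortened code; lines
  -- correspond to its words.
  let v : {i : Fin n // i ∉ S} → Fin 3 → F := fun i a => (b a : Fin n → F) i
  have hdot : ∀ x i, x ⬝ᵥ v i = (word x : Fin n → F) i := by
    intro x i
    simp [word, v, Module.Basis.equivFun_symm_apply, dotProduct]
  have hsurj : ∀ w ∈ shortenedCode C S, ∃ x, (word x : Fin n → F) = w := by
    intro w hw
    exact ⟨b.equivFun ⟨w, hw⟩, by simp [word]⟩
  -- Independence of fewer than k coordinates: no vanishing is forced at a new coordinate, so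
  -- columns are nonzero and pairwise non-proportional.
  have hle : ∀ S' T : Finset (Fin n), S'.card + 1 = T.card → T.card < k →
      ¬ shortenedCode C S' ≤ shortenedCode C T := by
    intro S' T hST hT hle
    have h1 := Submodule.finrank_mono hle
    have h2 := hfin S' (by omega)
    have h4 := hfin T hT
    omega
  have hne : ∀ i, v i ≠ 0 := by
    rintro ⟨i, hi⟩ h0
    refine hle S (insert i S) (by rw [Finset.card_insert_of_notMem hi])
      (by rw [Finset.card_insert_of_notMem hi]; omega) fun w hw => ?_
    obtain ⟨x, rfl⟩ := hsurj w hw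
    obtain ⟨hwC, hwS⟩ := mem_shortenedCode.mp hw
    refine mem_shortenedCode.mpr ⟨hwC, fun j hj => ?_⟩
    rcases Finset.mem_insert.mp hj with rfl | hj
    · rw [← hdot x ⟨j, hi⟩, h0, dotProduct_zero]
    · exact hwS j hj
  have harc : IsThreeArc v := by
    refine ⟨hne, ?_, ?_⟩
    · rintro ⟨i, hi⟩ ⟨j, hj⟩ hij h0
      obtain ⟨c, hc⟩ := exists_smul_of_cross_eq_zero (hne _) h0
      have hij' : j ≠ i := fun h => hij (Subtype.ext h.symm)
      have hj' : j ∉ insert i S := by simp [hij', hj]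
      refine hle (insert i S) (insert j (insert i S)) (by rw [Finset.card_insert_of_notMem hj'])
        (by rw [Finset.card_insert_of_notMem hj', Finset.card_insert_of_notMem hi]; omega)
        fun w hw => ?_
      obtain ⟨hwC, hwS⟩ := mem_shortenedCode.mp hw
      obtain ⟨x, rfl⟩ := hsurj w (mem_shortenedCode.mpr
        ⟨hwC, fun a ha => hwS a (Finset.mem_insert_of_mem ha)⟩)
      refine mem_shortenedCode.mpr ⟨hwC, fun a ha => ?_⟩
      rcases Finset.mem_insert.mp ha with rfl | ha
      · rw [← hdot x ⟨a, hj⟩, hc, dotProduct_smul, hdot, hwS i (Finset.mem_insert_self i S),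
          smul_zero]
      · exact hwS a ha
    · intro x hx
      have hwx : (word x : Fin n → F) ≠ 0 := by
        intro h0
        have h1 : word x = 0 := Subtype.ext h0
        exact hx (b.equivFun.symm.map_eq_zero_iff.mp h1)
      obtain ⟨hwC, hwS⟩ := mem_shortenedCode.mp (word x).2
      have h1 := hzero _ hwC hwx
      -- The word has at most k zeros, and k - 3 of them are in `S`, which leaves at most three
      -- points on the line.
      have h2 : ((pointsOn v x).map (Function.Embedding.subtype _)) ∪ S ⊆
          zeroSet (word x : Fin n → F) := by
        intro a ha
        rw [mem_zeroSet]
        rcases Finset.mem_union.mp ha with ha | ha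
        · obtain ⟨i, hi, rfl⟩ := Finset.mem_map.mp ha
          rw [Function.Embedding.subtype_apply, ← hdot]
          exact mem_pointsOn.mp hi
        · exact hwS a ha
      have h4 := Finset.card_le_card h2
      rw [Finset.card_union_of_disjoint, Finset.card_map] at h4
      · omega
      · rw [Finset.disjoint_left]
        intro a ha
        obtain ⟨i, -, rfl⟩ := Finset.mem_map.mp ha
        exact i.2
  have h := harc.card_le_two_mul_add_one hq
  have hcard : Fintype.card {i : Fin n // i ∉ S} = n - (k - 3) := by
    rw [Fintype.card_subtype_compl, Fintype.card_fin, Fintype.card_coe, hS]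
  omega

end Codes

/-! ### Bounds from the two Singleton defects. -/

section Codes

variable {F : Type*} [Field F] [DecidableEq F] {n : ℕ}

/-- The data on a code `C` of dimension `k` and Singleton defect `s`, whose dual code has Singleton
defect `t`, in terms of zeros of codewords and weights of dual words. -/
structure HasDefects (C : Submodule F (Fin n → F)) (k s t : ℕ) : Prop where
  nondegenerate : IsNondegenerateCode C
  finrank_eq : Module.finrank F C = k
  card_zeroSet_lt : ∀ x ∈ C, x ≠ 0 → (zeroSet x).card + 1 ≤ k + s
  exists_card_zeroSet : ∃ x ∈ C, x ≠ 0 ∧ (zeroSet x).card + 1 = k + s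
  le_hammingNorm : ∀ y ∈ dualCode C, y ≠ 0 → k + 1 ≤ hammingNorm y + t
  exists_hammingNorm : ∃ y ∈ dualCode C, y ≠ 0 ∧ hammingNorm y + t = k + 1
  defect_lt : t + 1 ≤ k

/-- A word of weight one in the dual code forces a coordinate to vanish on the code. -/
theorem one_lt_hammingNorm_of_mem_dualCode {C : Submodule F (Fin n → F)}
    (hnd : IsNondegenerateCode C) {y : Fin n → F} (hy : y ∈ dualCode C) (h0 : y ≠ 0) :
    1 < hammingNorm y := by
  by_contra! hle
  obtain ⟨i, hi⟩ := Function.ne_iff.mp h0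
  rw [Pi.zero_apply] at hi
  obtain ⟨x, hx, hxi⟩ := hnd i
  have hsupp : ∀ j, j ≠ i → y j = 0 := by
    intro j hj
    by_contra hne
    exact hj (Finset.card_le_one.mp hle j (by simpa using hne) i (by simpa using hi))
  have h := hy x hx
  rw [dotProduct, Finset.sum_eq_single i (fun j _ hj => by rw [hsupp j hj, zero_mul])
    (fun h => absurd (Finset.mem_univ i) h)] at h
  exact mul_ne_zero hi hxi h

/-- A coordinate vanishing on the dual would put a unit vector, of weight one, in the double dual
`C`. -/
theorem isNondegenerateCode_dualCode {C : Submodule F (Fin n → F)}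
    (h : ∀ x ∈ C, x ≠ 0 → 1 < hammingNorm x) : IsNondegenerateCode (dualCode C) := by
  intro i
  by_contra! H
  have hmem : (Pi.single i 1 : Fin n → F) ∈ C := by
    rw [← dualCode_dualCode C]
    intro y hy
    simp [H y hy]
  refine absurd (h _ hmem (by simp)) (not_lt.mpr ?_)
  refine Finset.card_le_one.mpr fun a ha b hb => ?_
  have key : ∀ a, (Pi.single i 1 : Fin n → F) a ≠ 0 → a = i := by
    intro a ha
    by_contra hne
    exact ha (Pi.single_eq_of_ne hne 1)
  rw [key a (by simpa using ha), key b (by simpa using hb)]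

theorem IsAMDSCode.hasDefects {C : Submodule F (Fin n → F)} {s k d t k' d' : ℕ}
    (hnd : IsNondegenerateCode C) (hC : IsAMDSCode C s k d)
    (hC' : IsAMDSCode (dualCode C) t k' d') : HasDefects C k s t := by
  obtain ⟨hL, hs⟩ := hC
  obtain ⟨hL', ht⟩ := hC'
  unfold singletonDefect at hs ht
  have hn := finrank_dualCode C
  rw [hL.1, hL'.1] at hn
  obtain ⟨x, hx, hx0, hxd⟩ := hL.exists_hammingNorm_eq
  obtain ⟨y, hy, hy0, hyd⟩ := hL'.exists_hammingNorm_eq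
  -- The minimum dual weight k + 1 - t exceeds 1, whence t < k.
  have hy1 := one_lt_hammingNorm_of_mem_dualCode hnd hy hy0
  refine ⟨hnd, hL.1, fun u hu hu0 => ?_, ⟨x, hx, hx0, ?_⟩, fun u hu hu0 => ?_,
    ⟨y, hy, hy0, ?_⟩, ?_⟩
  · have h1 := hL.le_hammingNorm hu hu0
    have h2 := card_zeroSet_add_hammingNorm u
    omega
  · have h2 := card_zeroSet_add_hammingNorm x
    omega
  · have h1 := hL'.le_hammingNorm hu hu0
    omega
  · omega
  · omega

namespace HasDefects

variable {C : Submodule F (Fin n → F)} {k s t : ℕ}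

theorem le_length (h : HasDefects C k s t) : k ≤ n := by
  have := finrank_dualCode C
  have := h.finrank_eq
  omega

section Fintype

variable [Fintype F]

/-- A pencil containing `x` with k - 2 common zeros inside the zeros of `x`; each of the q other
members has at most s + 1 zeros beyond these. -/
theorem length_le_of_word (h : HasDefects C k s t) (hk : 2 ≤ k) {x : Fin n → F} (hx : x ∈ C)
    (hz : k ≤ (zeroSet x).card + 2) :
    n ≤ (zeroSet x).card + Fintype.card F * (s + 1) := by
  obtain ⟨S, hS, hcard⟩ := Finset.exists_subset_card_eq (s := zeroSet x) (n := k - 2) (by omega)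
  have h1 := card_add_mul_card_le (N := k + s - 1) (S := S) (T := S)
    (fun u hu hu0 => by have := h.card_zeroSet_lt u hu hu0; omega)
    (by rw [h.finrank_eq]; omega) (fun u _ hu => hu) hx
    (fun i hi => mem_zeroSet.mp (hS hi))
  have h2 : k + s - 1 = S.card + (s + 1) := by omega
  rw [h2, mul_add] at h1
  omega

/-- The length bound for codes of dimension at least two and given defect. -/
theorem length_add_two_le (h : HasDefects C k s t) (hk : 2 ≤ k) :
    n + 2 ≤ k + (s + 1) * (Fintype.card F + 1) := by
  obtain ⟨x, hx, -, hz⟩ := h.exists_card_zeroSet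
  obtain ⟨S, -, hS⟩ := Finset.exists_subset_card_eq
    (s := (Finset.univ : Finset (Fin n))) (n := k - 2)
    (by rw [Finset.card_univ, Fintype.card_fin]; have := h.le_length; omega)
  have h1 := h.length_le_of_word hk hx (by omega)
  have h2 : (s + 1) * (Fintype.card F + 1) = Fintype.card F * (s + 1) + (s + 1) := by ring
  omega

/-- Vanishing on the support of a dual word except at one position forces vanishing there too. As t
> 1, that punctured support has at most k - 2 elements, so k - 2 conditions produce k - 1 common
zeros. -/
theorem length_add_one_le (h : HasDefects C k s t) (ht : 1 < t) :
    n + 1 ≤ k + s * (Fintype.card F + 1) := by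
  have hkn := h.le_length
  have htk := h.defect_lt
  obtain ⟨y, hy, hy0, hyt⟩ := h.exists_hammingNorm
  obtain ⟨i, hi⟩ := Function.ne_iff.mp hy0
  rw [Pi.zero_apply] at hi
  let Y : Finset (Fin n) := Finset.univ.filter fun j => y j ≠ 0
  have hY : Y.card = hammingNorm y := rfl
  have hiY : i ∈ Y := by simpa [Y] using hi
  obtain ⟨S, hYS, hSi, hS⟩ := Finset.exists_subsuperset_card_eq (n := k - 2)
    (Finset.erase_subset_erase i (Finset.subset_univ Y))
    (by rw [Finset.card_erase_of_mem hiY]; omega)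
    (by rw [Finset.card_erase_of_mem (Finset.mem_univ i), Finset.card_univ, Fintype.card_fin]
        omega)
  have hiS : i ∉ S := fun hmem => Finset.notMem_erase i _ (hSi hmem)
  have hST : ∀ u ∈ C, (∀ j ∈ S, u j = 0) → ∀ j ∈ insert i S, u j = 0 := by
    intro u hu huS j hj
    rcases Finset.mem_insert.mp hj with rfl | hj
    · have h0 := hy u hu
      rw [dotProduct, Finset.sum_eq_single j] at h0
      · exact (mul_eq_zero.mp h0).resolve_left hi
      · intro a _ ha
        by_cases hya : y a = 0
        · rw [hya, zero_mul]
        · rw [huS a (hYS (Finset.mem_erase.mpr ⟨ha, by simpa [Y] using hya⟩)), mul_zero]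
      · exact fun h => absurd (Finset.mem_univ j) h
    · exact huS j hj
  have hdim := finrank_le_finrank_shortenedCode_add C S
  rw [h.finrank_eq] at hdim
  -- Avoiding the multiples of 0 just means being nonzero.
  obtain ⟨g, hg, hg0⟩ := exists_mem_forall_ne_smul (W := shortenedCode C S) (by omega) 0
  obtain ⟨hgC, hgS⟩ := mem_shortenedCode.mp hg
  have hgz := h.card_zeroSet_lt g hgC (by simpa using hg0 0)
  have h1 := card_add_mul_card_le (N := k + s - 1) (S := S) (T := insert i S)
    (fun u hu hu0 => by have := h.card_zeroSet_lt u hu hu0; omega)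
    (by rw [h.finrank_eq]; omega) hST hgC hgS
  rw [Finset.card_insert_of_notMem hiS] at h1
  have h2 : k + s - 1 = S.card + 1 + s := by omega
  rw [h2, mul_add _ (S.card + 1) s] at h1
  have h3 : s * (Fintype.card F + 1) = Fintype.card F * s + s := by ring
  omega

theorem length_add_two_le_of_near (h : HasDefects C k 1 1) (hk : 3 ≤ k)
    (hq : 3 < Fintype.card F) : n + 2 ≤ 2 * Fintype.card F + k :=
  length_le_of_nearMDS h.finrank_eq hk
    (fun u hu hu0 => by have := h.card_zeroSet_lt u hu hu0; omega)
    (fun y hy hy0 => by have := h.le_hammingNorm y hy hy0; omega) hq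

end Fintype

theorem le_maxMDSLength (h : HasDefects C k s 1) :
    ((k + s - 1 : ℕ) : ℕ∞) ≤ maxMDSLength F (k - 1) := by
  obtain ⟨x, hx, hx0, hz⟩ := h.exists_card_zeroSet
  have hk := h.defect_lt
  have hcard : k + s - 1 = (zeroSet x).card := by omega
  rw [hcard]
  exact card_zeroSet_le_maxMDSLength h.finrank_eq hk h.nondegenerate
    (fun y hy hy0 => by have := h.le_hammingNorm y hy hy0; omega) hx hx0 (by omega)

end HasDefects

end Codes

theorem mainTheorem1 {F : Type*} [Field F] [Fintype F] [DecidableEq F]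
    (q : ℕ) (hq : Fintype.card F = q)
    (n k d s k' d' t : ℕ) (C : Submodule F (Fin n → F))
    (hnd : IsNondegenerateCode C)
    (hC : IsAMDSCode C s k d)
    (hC' : IsAMDSCode (dualCode C) t k' d')
    (hd : 1 < d) (hs : 1 ≤ s) (ht : 1 ≤ t) :
    -- (1a), (1b)
    (1 < t → (n : ℤ) ≤ s * (q + 1) + k - 1) ∧
    (1 < s → (k : ℤ) ≤ t * (q + 1) - 1) ∧
    -- (2)
    (t = 1 → ∀ α : ℕ, α ≤ s + 1 → (∃ x ∈ C, hammingNorm x = d + s + 1 - α) →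
      (n : ℤ) ≤ q * (s + 1) + k - 2 + α) ∧
    -- (3)
    (s = 1 → (n : ℤ) ≤ (t + 1) * (q + 1) + k' - 2 ∧ (k : ℤ) ≤ (t + 1) * (q + 1) - 2) ∧
    -- (4)
    (s = 1 → t = 1 → 3 < q → 3 ≤ k →
      (n : ℤ) ≤ 2 * q + k - 2 ∧ (k + 2 < n → (k : ℤ) ≤ 2 * q - 2)) ∧
    -- (5); here `2 ≤ k` and `s < k'`, so the subtractions are not truncated
    (t = 1 → ((k + s - 1 : ℕ) : ℕ∞) ≤ maxMDSLength F (k - 1) ∧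
      (n : ℕ∞) ≤ maxMDSLength F (k - 1) + ((k' - s + 1 : ℕ) : ℕ∞)) ∧
    -- (6); here `2 ≤ k'` and `t < k`, so the subtractions are not truncated
    (s = 1 → ((k' + t - 1 : ℕ) : ℕ∞) ≤ maxMDSLength F (k' - 1) ∧
      (n : ℕ∞) ≤ maxMDSLength F (k' - 1) + ((k - t + 1 : ℕ) : ℕ∞)) ∧
    -- (7)
    (s = 1 → t = 1 → (k : ℕ∞) ≤ maxMDSLength F (k - 1) ∧
      (k' : ℕ∞) ≤ maxMDSLength F (k' - 1)) ∧
    -- (8)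
    (k : ℤ) ≤ (t + 1) * (q + 1) - 2 := by
  subst hq
  have hn := finrank_dualCode C
  rw [hC.1.1, hC'.1.1] at hn
  have h := IsAMDSCode.hasDefects hnd hC hC'
  have hnd' : IsNondegenerateCode (dualCode C) :=
    isNondegenerateCode_dualCode fun x hx hx0 => hd.trans_le (hC.1.le_hammingNorm hx hx0)
  have h' : HasDefects (dualCode C) k' t s :=
    IsAMDSCode.hasDefects hnd' hC' ((dualCode_dualCode C).symm ▸ hC)
  have hk := h.defect_lt
  have hk' := h'.defect_lt
  -- The pencil bound for the dual, combined with n = k + k', also bounds k.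
  have hstd' := h'.length_add_two_le (by omega)
  have hdefect := hC.2
  unfold singletonDefect at hdefect
  have h5 : t = 1 → ((k + s - 1 : ℕ) : ℕ∞) ≤ maxMDSLength F (k - 1) := by
    rintro rfl
    exact h.le_maxMDSLength
  have h6 : s = 1 → ((k' + t - 1 : ℕ) : ℕ∞) ≤ maxMDSLength F (k' - 1) := by
    rintro rfl
    exact h'.le_maxMDSLength
  refine ⟨fun ht1 => ?_, fun hs1 => ?_, fun ht1 α hα hx => ?_, fun hs1 => ⟨?_, ?_⟩,
    fun hs1 ht1 hq hk3 => ⟨?_, fun hkn => ?_⟩, fun ht1 => ⟨h5 ht1, ?_⟩, fun hs1 => ⟨h6 hs1, ?_⟩,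
    fun hs1 ht1 => ⟨?_, ?_⟩, ?_⟩
  · have := h.length_add_one_le ht1
    zify at this
    linarith
  · have := h'.length_add_one_le hs1
    zify at this hn
    linarith
  · obtain ⟨x, hx, hw⟩ := hx
    have hz := card_zeroSet_add_hammingNorm x
    -- Here n - d = k + s - 1, so weight d + s + 1 - α means k - 2 + α zeros.
    have hcard : (zeroSet x).card + 2 = k + α := by omega
    have := h.length_le_of_word (by omega) hx (by omega)
    zify at this hcard
    linarith
  · zify at hstd'
    linarith
  · zify at hstd' hn
    linarith
  · subst hs1 ht1
    have := h.length_add_two_le_of_near hk3 hq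
    omega
  · subst hs1 ht1
    have := h'.length_add_two_le_of_near (by omega) hq
    omega
  -- The equivalent form follows from n = (k + s - 1) + (k' - s + 1).
  · refine le_trans ?_ (add_le_add_left (h5 ht1) _)
    rw [← Nat.cast_add]
    exact Nat.cast_le.mpr (by omega)
  · refine le_trans ?_ (add_le_add_left (h6 hs1) _)
    rw [← Nat.cast_add]
    exact Nat.cast_le.mpr (by omega)
  · have := h5 ht1
    rwa [hs1, Nat.add_sub_cancel] at this
  · have := h6 hs1
    rwa [ht1, Nat.add_sub_cancel] at this
  · zify at hstd' hn
    linarith
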